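/- \textbf{Conventions.} A continuous map $f\colon Y\to X$ of topological spaces is \emph{proper} if it is universally closed (i.e. $f\times\mathrm{id}\colon Y\times T\to X\times T$ is closed for every topological space $T$), and \emph{separated} if the diagonal is closed in $Y\times_X Y$. It is \emph{locally proper} if for every $y\in Y$ and every neighbourhood $V$ of $y$ there are neighbourhoods $A\subset V$ of $y$ and $U$ of $f(y)$ with $f(A)\subset U$ such that the induced map $A\to U$ is proper. Let $\operatorname{Sh}(X)$ be the category of sheaves of abelian groups on $X$ and $D^+(X)$ the full triangulated subcategory of its derived category consisting of the complexes with bounded below cohomology sheaves. The \emph{proper direct image} $f_{(!)}\colon\operatorname{Sh}(Y)\to\operatorname{Sh}(X)$ is the subfunctor of the direct image $f_{(*)}$ given by $$(f_{(!)}\mathcal F)(U)=\{s\in\mathcal F(f^{-1}(U)) \mid f\colon \operatorname{supp}(s)\to U \text{ is proper}\}\qquad (U\subset X\text{ open}),$$ and $f_!=\mathrm R f_{(!)}\colon D^+(Y)\to D^+(X)$ denotes its right derived functor. If $f\colon Y\to X$ is separated and $g\colon Z\to Y$ is continuous, then the identity $f_{(*)}\circ g_{(*)}=(f\circ g)_{(*)}$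 restricts to an identity $f_{(!)}\circ g_{(!)}=(f\circ g)_{(!)}$. \textbf{Theorem (Iterated derived proper images).} Let $g\colon Z\to Y$ and $f\colon Y\to X$ be separated locally proper maps of topological spaces. Then the morphism of right derived functors induced by the identity $f_{(!)}\circ g_{(!)}=(f\circ g)_{(!)}$ is an isomorphism $$(f\circ g)_!\ \xrightarrow{\ \sim\ }\ f_!\circ g_!$$ of triangulated functors $D^+(Z)\to D^+(X)$. -/

import Mathlib

open CategoryTheory TopologicalSpace Opposite Topology

universe u w₁ w₂ w₃

/-- A map of topological spaces is locally proper if it is continuous and if for every point `y`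
and every neighbourhood `V` of `y` there are neighbourhoods `A ⊆ V` of `y` and `U` of `f y` with
`f(A) ⊆ U` such that the induced map `A → U` is proper. -/
def IsLocallyProper {Y X : Type*} [TopologicalSpace Y] [TopologicalSpace X] (f : Y → X) : Prop :=
  Continuous f ∧ ∀ (y : Y), ∀ V ∈ 𝓝 y, ∃ A ∈ 𝓝 y, ∃ U ∈ 𝓝 (f y),
    A ⊆ V ∧ ∃ h : Set.MapsTo f A U, IsProperMap (h.restrict f A U)

/-- The category `Sh(X)` of sheaves of abelian groups on `X`. -/
abbrev Sh (X : TopCat.{u}) := TopCat.Sheaf AddCommGrpCat.{u} X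

namespace Sh

variable {X Y Z : TopCat.{u}}

/-- The support of a section `s` of a sheaf over an open subset `V`: the points of `V` at which
the germ of `s` is nonzero. -/
def supp (F : Sh Y) {V : Opens Y} (s : F.presheaf.obj (op V)) : Set Y :=
  {y | ∃ h : y ∈ V, F.presheaf.germ V y h s ≠ 0}

lemma supp_subset (F : Sh Y) {V : Opens Y} (s : F.presheaf.obj (op V)) :
    supp F s ⊆ V := fun _ h ↦ h.1

lemma notMem_supp_iff (F : Sh Y) {V : Opens Y} (s : F.presheaf.obj (op V)) (y : Y) (hy : y ∈ V) :
    y ∉ supp F s ↔ ∃ W : Opens Y, y ∈ W ∧ ∃ i : W ⟶ V, F.presheaf.map i.op s = 0 := by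
  simp only [supp, Set.mem_ofPred_eq, not_exists, not_not, ne_eq]
  constructor
  · intro h
    have h0 : F.presheaf.germ V y hy s = F.presheaf.germ V y hy 0 := by rw [h hy, map_zero]
    obtain ⟨W, hW, i, j, e⟩ := F.presheaf.germ_eq y hy hy s 0 h0
    exact ⟨W, hW, i, by rw [e, map_zero]⟩
  · rintro ⟨W, hW, i, e⟩ _
    rw [← F.presheaf.germ_res_apply i y hW s, e, map_zero]

lemma mem_of_supp_mem (F : Sh Y) {V : Opens Y} (s : F.presheaf.obj (op V))
    (𝒰 : Ultrafilter Y) (h : supp F s ∈ 𝒰) (y : Y) (hy : y ∈ V) (hle : ↑𝒰 ≤ 𝓝 y) :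
    y ∈ supp F s := by
  by_contra hn
  obtain ⟨W, hW, i, e⟩ := (notMem_supp_iff F s y hy).1 hn
  have hW' : (W : Set Y) ∈ 𝒰 := hle (W.isOpen.mem_nhds hW)
  obtain ⟨z, hz, hzW⟩ := 𝒰.nonempty_of_mem (Filter.inter_mem h hW')
  exact (notMem_supp_iff F s z hz.1).2 ⟨W, hzW, i, e⟩ hz

lemma supp_zero (F : Sh Y) (V : Opens Y) : supp F (0 : F.presheaf.obj (op V)) = ∅ := by
  ext y; simp [supp]

lemma supp_add (F : Sh Y) {V : Opens Y} (s t : F.presheaf.obj (op V)) :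
    supp F (s + t) ⊆ supp F s ∪ supp F t := by
  rintro y ⟨hy, h⟩
  by_contra hn
  simp only [supp, Set.mem_union, Set.mem_ofPred_eq, not_or, not_exists, not_not, ne_eq] at hn
  exact h (by rw [map_add, hn.1 hy, hn.2 hy, add_zero])

lemma supp_neg (F : Sh Y) {V : Opens Y} (s : F.presheaf.obj (op V)) :
    supp F (-s) = supp F s := by
  ext y; simp [supp]

lemma supp_map (F : Sh Y) {V W : Opens Y} (i : W ⟶ V) (s : F.presheaf.obj (op V)) :
    supp F (F.presheaf.map i.op s) = supp F s ∩ W := by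
  ext y
  constructor
  · rintro ⟨hy, h⟩
    exact ⟨⟨i.le hy, by rwa [F.presheaf.germ_res_apply] at h⟩, hy⟩
  · rintro ⟨⟨hV, h⟩, hy⟩
    exact ⟨hy, by rwa [F.presheaf.germ_res_apply]⟩

lemma supp_app {F G : Sh Y} (φ : F ⟶ G) {V : Opens Y} (s : F.presheaf.obj (op V)) :
    supp G (φ.1.app (op V) s) ⊆ supp F s := by
  rintro y ⟨hy, h⟩
  refine ⟨hy, fun h0 ↦ h ?_⟩
  rw [← TopCat.Presheaf.stalkFunctor_map_germ_apply, h0]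
  exact map_zero (ConcreteCategory.hom
    ((TopCat.Presheaf.stalkFunctor AddCommGrpCat.{u} y).map φ.1))

/-- For an open subset `U` of `X`, a section `s ∈ F(f⁻¹(U))` has proper support over `U` if the
map `supp s → U` induced by `f` is proper. -/
def HasProperSupport (f : Y ⟶ X) (F : Sh Y) (U : Opens X)
    (s : F.presheaf.obj (op ((Opens.map f).obj U))) : Prop :=
  IsProperMap (fun y : supp F s ↦ (⟨f y, y.2.1⟩ : U))

lemma hasProperSupport_iff (f : Y ⟶ X) (F : Sh Y) (U : Opens X)
    (s : F.presheaf.obj (op ((Opens.map f).obj U))) :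
    HasProperSupport f F U s ↔ ∀ 𝒰 : Ultrafilter Y, supp F s ∈ 𝒰 → ∀ x ∈ U,
      Filter.Tendsto f 𝒰 (𝓝 x) → ∃ y ∈ (Opens.map f).obj U, f y = x ∧ ↑𝒰 ≤ 𝓝 y := by
  unfold HasProperSupport
  rw [isProperMap_iff_ultrafilter]
  constructor
  · rintro ⟨-, h⟩ 𝒰 hs x hx ht
    have hr : Set.range (Subtype.val : supp F s → Y) ∈ 𝒰 := by simpa using! hs
    let 𝒱 : Ultrafilter (supp F s) := 𝒰.comap Subtype.val_injective hr
    have hmap : Filter.map Subtype.val (𝒱 : Filter (supp F s)) = 𝒰 := by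
      rw [Ultrafilter.coe_comap]; exact Filter.map_comap_of_mem hr
    obtain ⟨y, hy, hle⟩ := @h 𝒱 ⟨x, hx⟩ (by
      rw [tendsto_subtype_rng]
      change Filter.Tendsto (f ∘ Subtype.val) (𝒱 : Filter (supp F s)) (𝓝 x)
      rw [← Filter.tendsto_map'_iff, hmap]
      exact ht)
    refine ⟨y, y.2.1, congrArg Subtype.val hy, ?_⟩
    rw [← hmap]
    exact (Filter.map_mono hle).trans continuous_subtype_val.continuousAt
  · intro h
    refine ⟨by fun_prop, fun 𝒱 x ht ↦ ?_⟩
    have hs : supp F s ∈ 𝒱.map Subtype.val := by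
      rw [Ultrafilter.mem_map]
      exact Filter.univ_mem' fun y ↦ y.2
    rw [tendsto_subtype_rng] at ht
    obtain ⟨y, hyU, hy, hle⟩ := h (𝒱.map Subtype.val) hs x x.2 (by
      rw [Ultrafilter.coe_map, Filter.tendsto_map'_iff]; exact ht)
    refine ⟨⟨y, mem_of_supp_mem F s _ hs y hyU hle⟩, Subtype.ext hy, ?_⟩
    rw [nhds_subtype, ← Filter.map_le_iff_le_comap]
    exact hle

/-- The group `(f_(!) F)(U)` of the sections `s ∈ F(f⁻¹(U))` with proper support over `U`. -/
def properSections (f : Y ⟶ X) (F : Sh Y) (U : Opens X) :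
    AddSubgroup (F.presheaf.obj (op ((Opens.map f).obj U))) where
  carrier := {s | HasProperSupport f F U s}
  zero_mem' := by
    rw [Set.mem_ofPred_eq, hasProperSupport_iff]
    intro 𝒰 h
    rw [supp_zero] at h
    exact (𝒰.empty_notMem h).elim
  add_mem' {s t} hs ht := by
    rw [Set.mem_ofPred_eq, hasProperSupport_iff] at *
    intro 𝒰 h x hx hf
    rcases Ultrafilter.union_mem_iff.1 (Filter.mem_of_superset h (supp_add F s t)) with h | h
    · exact hs 𝒰 h x hx hf
    · exact ht 𝒰 h x hx hf
  neg_mem' {s} hs := by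
    rw [Set.mem_ofPred_eq, hasProperSupport_iff] at *
    rwa [supp_neg]

lemma mem_properSections (f : Y ⟶ X) (F : Sh Y) (U : Opens X)
    (s : F.presheaf.obj (op ((Opens.map f).obj U))) :
    s ∈ properSections f F U ↔ HasProperSupport f F U s := Iff.rfl

lemma map_mem_properSections (f : Y ⟶ X) (F : Sh Y) {U V : Opens X} (i : V ⟶ U)
    {s : F.presheaf.obj (op ((Opens.map f).obj U))} (hs : s ∈ properSections f F U) :
    F.presheaf.map ((Opens.map f).map i).op s ∈ properSections f F V := by
  rw [mem_properSections, hasProperSupport_iff] at *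
  intro 𝒰 h x hx hf
  rw [supp_map] at h
  obtain ⟨y, -, rfl, hle⟩ := hs 𝒰 (Filter.mem_of_superset h Set.inter_subset_left) x (i.le hx) hf
  exact ⟨y, hx, rfl, hle⟩

lemma app_mem_properSections (f : Y ⟶ X) {F G : Sh Y} (φ : F ⟶ G) (U : Opens X)
    {s : F.presheaf.obj (op ((Opens.map f).obj U))} (hs : s ∈ properSections f F U) :
    φ.1.app _ s ∈ properSections f G U := by
  rw [mem_properSections, hasProperSupport_iff] at *
  exact fun 𝒰 h ↦ hs 𝒰 (Filter.mem_of_superset h (supp_app φ s))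

lemma mem_properSections_of_cover (f : Y ⟶ X) (F : Sh Y) {ι : Type*} {U : Opens X}
    (V : ι → Opens X) (i : ∀ k, V k ⟶ U) (hV : U ≤ iSup V)
    {s : F.presheaf.obj (op ((Opens.map f).obj U))}
    (hs : ∀ k, F.presheaf.map ((Opens.map f).map (i k)).op s ∈ properSections f F (V k)) :
    s ∈ properSections f F U := by
  rw [mem_properSections, hasProperSupport_iff]
  intro 𝒰 h x hx hf
  obtain ⟨k, hk⟩ := Opens.mem_iSup.1 (hV hx)
  have h1 := (hasProperSupport_iff f F _ _).1 (hs k)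
  have h2 : f ⁻¹' (V k) ∈ (𝒰 : Filter Y) := hf ((V k).isOpen.mem_nhds hk)
  obtain ⟨y, hy, hyx, hle⟩ := h1 𝒰 (by rw [supp_map]; exact Filter.inter_mem h h2) x hk hf
  exact ⟨y, ((Opens.map f).map (i k)).le hy, hyx, hle⟩

/-- The presheaf `U ↦ (f_(!) F)(U)`, a subpresheaf of the direct image `f_(*) F`. -/
def properDirectImagePresheaf (f : Y ⟶ X) (F : Sh Y) : TopCat.Presheaf AddCommGrpCat.{u} X where
  obj U := AddCommGrpCat.of (properSections f F U.unop)
  map {U V} i := AddCommGrpCat.ofHom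
    (((F.presheaf.map ((Opens.map f).map i.unop).op).hom.comp
      (properSections f F U.unop).subtype).codRestrict (properSections f F V.unop)
        fun s ↦ map_mem_properSections f F i.unop s.2)
  map_id U := by
    ext s
    exact ConcreteCategory.congr_hom (F.presheaf.map_id _) s.1
  map_comp i j := by
    ext s
    exact ConcreteCategory.congr_hom
      (F.presheaf.map_comp ((Opens.map f).map i.unop).op ((Opens.map f).map j.unop).op) s.1

lemma properDirectImagePresheaf_isSheaf (f : Y ⟶ X) (F : Sh Y) :
    (properDirectImagePresheaf f F).IsSheaf := by
  rw [TopCat.Presheaf.isSheaf_iff_isSheafUniqueGluing]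
  intro ι U sf hsf
  obtain ⟨s, hs, huniq⟩ := ((TopCat.Sheaf.pushforward AddCommGrpCat.{u} f).obj F).existsUnique_gluing
    U (fun i ↦ (sf i).1) (fun i j ↦ congrArg Subtype.val (hsf i j))
  refine ⟨⟨s, mem_properSections_of_cover f F U (Opens.leSupr U) le_rfl fun k ↦ ?_⟩, fun k ↦ ?_,
    fun t ht ↦ ?_⟩
  · have := hs k
    exact this ▸ (sf k).2
  · exact Subtype.ext (hs k)
  · exact Subtype.ext (huniq t.1 fun k ↦ congrArg Subtype.val (ht k))

/-- The proper direct image functor `f_(!) : Sh(Y) ⥤ Sh(X)`. -/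
def properDirectImage (f : Y ⟶ X) : Sh Y ⥤ Sh X where
  obj F := ⟨properDirectImagePresheaf f F, properDirectImagePresheaf_isSheaf f F⟩
  map {F G} φ := ⟨{
    app U := AddCommGrpCat.ofHom
      (((φ.1.app (op ((Opens.map f).obj U.unop))).hom.comp
        (properSections f F U.unop).subtype).codRestrict (properSections f G U.unop)
          fun s ↦ app_mem_properSections f φ U.unop s.2)
    naturality U V i := by
      ext s
      exact Subtype.ext (ConcreteCategory.congr_hom
        (φ.1.naturality ((Opens.map f).map i.unop).op) s.1) }⟩
  map_id F := rfl
  map_comp φ ψ := rfl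

/-- The inclusion of `f_(!)` into the direct image functor `f_(*)`. -/
def properDirectImageι (f : Y ⟶ X) :
    properDirectImage f ⟶ TopCat.Sheaf.pushforward AddCommGrpCat.{u} f where
  app F := ⟨{ app U := AddCommGrpCat.ofHom (properSections f F U.unop).subtype }⟩

instance properDirectImage_additive (f : Y ⟶ X) : (properDirectImage f).Additive where
  map_add := rfl


lemma exists_of_mem_nhds (F : Sh Y) {V W : Opens Y} (i : W ⟶ V) (s : F.presheaf.obj (op V))
    (h : F.presheaf.map i.op s ≠ 0) : ∃ y ∈ W, y ∈ supp F s := by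
  by_contra! hn
  refine h (TopCat.Presheaf.section_ext F W _ 0 fun y hy ↦ ?_)
  by_contra hne
  rw [map_zero] at hne
  have : y ∈ supp F (F.presheaf.map i.op s) := ⟨hy, hne⟩
  rw [supp_map] at this
  exact hn y hy this.1

lemma notMem_supp_properDirectImage (g : Z ⟶ Y) (F : Sh Z) {V : Opens Y}
    (s : properSections g F V) (y : Y) (hy : y ∈ V) :
    y ∉ supp ((properDirectImage g).obj F) (V := V) s ↔ ∃ W : Opens Y, y ∈ W ∧ ∃ i : W ⟶ V,
      F.presheaf.map ((Opens.map g).map i).op s.1 = 0 := by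
  refine (notMem_supp_iff ((properDirectImage g).obj F) (V := V) s y hy).trans ?_
  exact exists_congr fun W ↦ and_congr_right fun _ ↦ exists_congr fun i ↦
    ⟨fun h ↦ congrArg Subtype.val h, fun h ↦ Subtype.ext h⟩

lemma supp_properDirectImage (g : Z ⟶ Y) (F : Sh Z) {V : Opens Y} (s : properSections g F V) :
    supp ((properDirectImage g).obj F) (V := V) s = g '' supp F s.1 := by
  ext y
  constructor
  · intro hy
    have hyV : y ∈ V := hy.1
    have hne : (Filter.comap g (𝓝 y) ⊓ Filter.principal (supp F s.1)).NeBot := by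
      rw [Filter.inf_principal_neBot_iff]
      rintro T ⟨N, hN, hT⟩
      obtain ⟨W, hWN, hW, hyW⟩ := mem_nhds_iff.1 hN
      by_contra hempty
      refine (notMem_supp_properDirectImage g F s y hyV).2 ⟨⟨W, hW⟩ ⊓ V, ⟨hyW, hyV⟩,
        homOfLE inf_le_right, ?_⟩ hy
      by_contra hne
      obtain ⟨z, hz, hzs⟩ := exists_of_mem_nhds F _ s.1 hne
      exact hempty ⟨z, hT (hWN hz.1), hzs⟩
    let 𝒱 := Ultrafilter.of (Filter.comap g (𝓝 y) ⊓ Filter.principal (supp F s.1))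
    have h𝒱 := Ultrafilter.of_le (Filter.comap g (𝓝 y) ⊓ Filter.principal (supp F s.1))
    have hs𝒱 : supp F s.1 ∈ 𝒱 := Filter.le_principal_iff.1 (h𝒱.trans inf_le_right)
    obtain ⟨z, hz, hzy, hle⟩ := (hasProperSupport_iff g F V s.1).1 s.2 𝒱 hs𝒱 y hyV
      (Filter.tendsto_iff_comap.2 (h𝒱.trans inf_le_left))
    exact ⟨z, mem_of_supp_mem F _ 𝒱 hs𝒱 z hz hle, hzy⟩
  · rintro ⟨z, hz, rfl⟩
    by_contra hn
    obtain ⟨W, hW, i, h0⟩ := (notMem_supp_properDirectImage g F s (g z) hz.1).1 hn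
    exact (notMem_supp_iff F s.1 z hz.1).2 ⟨(Opens.map g).obj W, hW, (Opens.map g).map i, h0⟩ hz

lemma mem_properSections_comp_of_mem (g : Z ⟶ Y) (f : Y ⟶ X) (F : Sh Z) (U : Opens X)
    (s : properSections g F ((Opens.map f).obj U))
    (h : s ∈ properSections f ((properDirectImage g).obj F) U) :
    s.1 ∈ properSections (g ≫ f) F U := by
  refine (hasProperSupport_iff (g ≫ f) F U s.1).2 fun 𝒱 h𝒱 x hx hlim ↦ ?_
  obtain ⟨y, hy, hyx, hle⟩ := (hasProperSupport_iff f _ U _).1 h (𝒱.map g) (by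
    rw [supp_properDirectImage]
    exact Filter.image_mem_map h𝒱) x hx (by
      rw [Ultrafilter.coe_map, Filter.tendsto_map'_iff]; exact hlim)
  obtain ⟨z, hz, hzy, hle'⟩ := (hasProperSupport_iff g F _ s.1).1 s.2 𝒱 h𝒱 y hy hle
  exact ⟨z, hz, (congrArg f hzy).trans hyx, hle'⟩

lemma mem_properSections_left (g : Z ⟶ Y) (f : Y ⟶ X) (hf : IsSeparatedMap f) (F : Sh Z)
    (U : Opens X) (s : F.presheaf.obj (op ((Opens.map (g ≫ f)).obj U)))
    (h : s ∈ properSections (g ≫ f) F U) :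
    s ∈ properSections g F ((Opens.map f).obj U) := by
  refine (hasProperSupport_iff g F ((Opens.map f).obj U) s).2 fun 𝒱 h𝒱 y hy hlim ↦ ?_
  obtain ⟨z, hz, hzy, hle⟩ := (hasProperSupport_iff (g ≫ f) F U s).1 h 𝒱 h𝒱 (f y) hy
    ((f.hom.continuous.tendsto y).comp hlim)
  refine ⟨z, hz, ?_, hle⟩
  by_contra hne
  have hd := isSeparatedMap_iff_disjoint_nhds.1 hf (g z) y hzy hne
  exact hlim.not_tendsto hd.symm ((g.hom.continuous.tendsto z).mono_left hle)

lemma mem_properSections_right (g : Z ⟶ Y) (f : Y ⟶ X) (hf : IsSeparatedMap f) (F : Sh Z)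
    (U : Opens X) (s : F.presheaf.obj (op ((Opens.map (g ≫ f)).obj U)))
    (h : s ∈ properSections (g ≫ f) F U) :
    (⟨s, mem_properSections_left g f hf F U s h⟩ : properSections g F ((Opens.map f).obj U)) ∈
      properSections f ((properDirectImage g).obj F) U := by
  refine (hasProperSupport_iff f _ U _).2 fun 𝒰 h𝒰 x hx hlim ↦ ?_
  rw [supp_properDirectImage] at h𝒰
  have hmap : (𝒰 : Filter Y) = (Ultrafilter.ofComapInfPrincipal h𝒰).map g :=
    congrArg _ (Ultrafilter.ofComapInfPrincipal_eq_of_map h𝒰).symm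
  obtain ⟨z, hz, hzx, hle⟩ := (hasProperSupport_iff (g ≫ f) F U s).1 h
    (Ultrafilter.ofComapInfPrincipal h𝒰) (Ultrafilter.ofComapInfPrincipal_mem h𝒰) x hx (by
      rw [hmap, Ultrafilter.coe_map, Filter.tendsto_map'_iff] at hlim
      exact hlim)
  refine ⟨g z, hz, hzx, ?_⟩
  rw [hmap]
  exact (Filter.map_mono hle).trans (g.hom.continuous.tendsto z)

/-- The identity `f_(!) ∘ g_(!) = (f ∘ g)_(!)` for separated `f`: both sides consist of the same
sections of `F` over the open subsets `g⁻¹(f⁻¹(U))`, and the isomorphism does not change them. -/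
def properDirectImageComp (g : Z ⟶ Y) (f : Y ⟶ X) (hf : IsSeparatedMap f) :
    properDirectImage g ⋙ properDirectImage f ≅ properDirectImage (g ≫ f) where
  hom := {
    app F := ⟨{
      app U := AddCommGrpCat.ofHom
        { toFun s := ⟨s.1.1, mem_properSections_comp_of_mem g f F U.unop s.1 s.2⟩
          map_zero' := rfl
          map_add' _ _ := rfl } }⟩ }
  inv := {
    app F := ⟨{
      app U := AddCommGrpCat.ofHom
        { toFun s := ⟨⟨s.1, mem_properSections_left g f hf F U.unop s.1 s.2⟩,
            mem_properSections_right g f hf F U.unop s.1 s.2⟩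
          map_zero' := rfl
          map_add' _ _ := rfl } }⟩ }
  hom_inv_id := rfl
  inv_hom_id := rfl

lemma properDirectImageComp_hom_comp_ι (g : Z ⟶ Y) (f : Y ⟶ X) (hf : IsSeparatedMap f) :
    (properDirectImageComp g f hf).hom ≫ properDirectImageι (g ≫ f) =
      Functor.whiskerRight (properDirectImageι g) (properDirectImage f) ≫
        Functor.whiskerLeft (TopCat.Sheaf.pushforward AddCommGrpCat.{u} g)
          (properDirectImageι f) :=
  rfl

end Sh

namespace DerivedPlus

variable {A B C : Type*} [Category* A] [Category* B] [Category* C] [Abelian A] [Abelian B]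
  [Abelian C] [HasDerivedCategory A] [HasDerivedCategory B] [HasDerivedCategory C]

section

variable (A)

/-- The functor `K⁺(injectives of A) ⥤ D⁺(A)`. -/
noncomputable abbrev injectiveToDerived :
    HomotopyCategory.Plus (InjectiveObject A) ⥤ DerivedCategory.Plus A :=
  (InjectiveObject.ι A).mapHomotopyCategoryPlus ⋙ DerivedCategory.Plus.Qh

lemma Qh_map_bijective (K : HomotopyCategory.Plus A)
    (L : HomotopyCategory.Plus (InjectiveObject A)) : Function.Bijective
    (DerivedCategory.Plus.Qh.map :
      (K ⟶ (InjectiveObject.ι A).mapHomotopyCategoryPlus.obj L) → _) := by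
  obtain ⟨L, rfl⟩ := HomotopyCategory.Plus.quotient_obj_surjective L
  exact DerivedCategory.Plus.Qh_map_bijective_of_isKInjective _ _
    (inferInstanceAs (CochainComplex.IsKInjective
      (((InjectiveObject.ι A).mapHomologicalComplex (.up ℤ)).obj L.obj)))

instance full_injectiveToDerived : (injectiveToDerived A).Full where
  map_surjective {K L} f := by
    obtain ⟨g, rfl⟩ := (Qh_map_bijective A
      ((InjectiveObject.ι A).mapHomotopyCategoryPlus.obj K) L).2 f
    obtain ⟨h, rfl⟩ := (InjectiveObject.ι A).mapHomotopyCategoryPlus.map_surjective g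
    exact ⟨h, rfl⟩

instance faithful_injectiveToDerived : (injectiveToDerived A).Faithful where
  map_injective {K L} _ _ h :=
    (InjectiveObject.ι A).mapHomotopyCategoryPlus.map_injective
      ((Qh_map_bijective A ((InjectiveObject.ι A).mapHomotopyCategoryPlus.obj K) L).1 h)

instance isEquivalence_injectiveToDerived [EnoughInjectives A] :
    (injectiveToDerived A).IsEquivalence where

instance isLocalization_injectiveToDerived [EnoughInjectives A] :
    (injectiveToDerived A).IsLocalization (MorphismProperty.isomorphisms _) :=
  Functor.IsLocalization.of_isEquivalence _ _ le_rfl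

end

variable [EnoughInjectives A] (F : A ⥤ B) [F.Additive]

/-- On bounded below complexes of injectives the unit of `RF` is an isomorphism. -/
noncomputable def injectiveIso :
    injectiveToDerived A ⋙ F.rightDerivedFunctorPlus ≅
      (InjectiveObject.ι A).mapHomotopyCategoryPlus ⋙
        F.mapHomotopyCategoryPlus ⋙ DerivedCategory.Plus.Qh :=
  (NatIso.ofComponents (fun K ↦ asIso (F.rightDerivedFunctorPlusUnit.app
    ((InjectiveObject.ι A).mapHomotopyCategoryPlus.obj K)))
    fun _ ↦ F.rightDerivedFunctorPlusUnit.naturality _).symm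

/-- The commutation with shifts of `RF : D⁺(A) ⥤ D⁺(B)`; it is characterized by the fact that the
unit of the right derived functor commutes with shifts, see `commShift_unit` below. -/
noncomputable instance commShiftRightDerived : F.rightDerivedFunctorPlus.CommShift ℤ :=
  letI : Localization.Lifting (injectiveToDerived A) (MorphismProperty.isomorphisms _)
    ((InjectiveObject.ι A).mapHomotopyCategoryPlus ⋙
        F.mapHomotopyCategoryPlus ⋙ DerivedCategory.Plus.Qh) F.rightDerivedFunctorPlus :=
    ⟨injectiveIso F⟩
  Functor.commShiftOfLocalization (injectiveToDerived A) (MorphismProperty.isomorphisms _) ℤ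
    ((InjectiveObject.ι A).mapHomotopyCategoryPlus ⋙
        F.mapHomotopyCategoryPlus ⋙ DerivedCategory.Plus.Qh) F.rightDerivedFunctorPlus

lemma commShift_injectiveIso : NatTrans.CommShift (injectiveIso F).hom ℤ :=
  letI : Localization.Lifting (injectiveToDerived A) (MorphismProperty.isomorphisms _)
    ((InjectiveObject.ι A).mapHomotopyCategoryPlus ⋙
        F.mapHomotopyCategoryPlus ⋙ DerivedCategory.Plus.Qh) F.rightDerivedFunctorPlus :=
    ⟨injectiveIso F⟩
  NatTrans.commShift_iso_hom_of_localization (injectiveToDerived A)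
    (MorphismProperty.isomorphisms _) ℤ
    ((InjectiveObject.ι A).mapHomotopyCategoryPlus ⋙
        F.mapHomotopyCategoryPlus ⋙ DerivedCategory.Plus.Qh) F.rightDerivedFunctorPlus

/-- With this commutation with shifts, `RF` is a triangulated functor. -/
instance isTriangulated_rightDerived : F.rightDerivedFunctorPlus.IsTriangulated := by
  have := commShift_injectiveIso F
  exact Functor.isTriangulated_of_precomp_iso (injectiveIso F)

/-- The unit of `RF` is compatible with the shifts. -/
instance commShift_unit : NatTrans.CommShift F.rightDerivedFunctorPlusUnit ℤ where
  shift_comm a := by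
    refine NatTrans.ext (funext fun K ↦ ?_)
    let P := F.mapHomotopyCategoryPlus ⋙ (DerivedCategory.Plus.Qh (C := B))
    let R := DerivedCategory.Plus.Qh (C := A) ⋙ F.rightDerivedFunctorPlus
    let I := (InjectiveObject.ι A).mapHomotopyCategoryPlus
    let η : P ⟶ R := F.rightDerivedFunctorPlusUnit
    change (P.commShiftIso a).hom.app K ≫ (η.app K)⟦a⟧' =
      η.app (K⟦a⟧) ≫ (R.commShiftIso a).hom.app K
    have key (L : HomotopyCategory.Plus (InjectiveObject A)) :
        (P.commShiftIso a).hom.app (I.obj L) ≫ (η.app (I.obj L))⟦a⟧' =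
          η.app ((I.obj L)⟦a⟧) ≫ (R.commShiftIso a).hom.app (I.obj L) := by
      have := commShift_injectiveIso F
      have h : ((I ⋙ P).commShiftIso a).hom.app L ≫ (η.app (I.obj L))⟦a⟧' =
          η.app (I.obj (L⟦a⟧)) ≫ (((I ⋙ DerivedCategory.Plus.Qh) ⋙
            F.rightDerivedFunctorPlus).commShiftIso a).hom.app L :=
        NatTrans.shift_app_comm (injectiveIso F).inv a L
      have h' : (((I ⋙ DerivedCategory.Plus.Qh) ⋙
            F.rightDerivedFunctorPlus).commShiftIso a).hom.app L =
          R.map ((I.commShiftIso a).hom.app L) ≫ (R.commShiftIso a).hom.app (I.obj L) := by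
        simp [Functor.commShiftIso_comp_hom_app, R]
      rw [h', Functor.commShiftIso_comp_hom_app, Category.assoc, ← η.naturality_assoc] at h
      exact (cancel_epi _).1 h
    let r : (HomotopyCategory.Plus.localizerMorphism A).RightResolution K := Classical.arbitrary _
    have hr : IsIso (R.map r.w) := by
      have := Localization.inverts DerivedCategory.Plus.Qh _ _ r.hw
      dsimp [R]
      infer_instance
    rw [← cancel_mono ((R.map r.w)⟦a⟧'), Category.assoc, Category.assoc, ← Functor.map_comp,
      ← η.naturality, Functor.map_comp, ← Functor.commShiftIso_hom_naturality,
      ← Functor.commShiftIso_hom_naturality_assoc, ← η.naturality_assoc]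
    exact congrArg (P.map (r.w⟦a⟧') ≫ ·) (key r.X₁)

/-- For additive functors `F`, `G`, `H` and an isomorphism `e : F ⋙ G ≅ H`, the morphism
`RH ⟶ RF ⋙ RG` induced by `e`: it is given by the universal property of `RH`, i.e. it is the unique
morphism whose composition with the unit `H(K) ⟶ RH(K)` is
`H(K) ≅ G(F(K)) ⟶ RG(F(K)) ⟶ RG(RF(K))`, for all `K` in `K⁺(A)`. -/
noncomputable def rightDerivedComparison [EnoughInjectives B] {F : A ⥤ B} [F.Additive]
    {G : B ⥤ C} [G.Additive] {H : A ⥤ C} [H.Additive] (e : F ⋙ G ≅ H) :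
    H.rightDerivedFunctorPlus ⟶ F.rightDerivedFunctorPlus ⋙ G.rightDerivedFunctorPlus :=
  H.rightDerivedFunctorPlus.rightDerivedDesc H.rightDerivedFunctorPlusUnit
    (HomotopyCategory.Plus.quasiIso A)
    (F.rightDerivedFunctorPlus ⋙ G.rightDerivedFunctorPlus)
    (Functor.whiskerRight (Functor.mapHomotopyCategoryPlusCompIso e).inv DerivedCategory.Plus.Qh ≫
      Functor.whiskerLeft F.mapHomotopyCategoryPlus G.rightDerivedFunctorPlusUnit ≫
      Functor.whiskerRight F.rightDerivedFunctorPlusUnit G.rightDerivedFunctorPlus)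

end DerivedPlus

namespace Sh

variable {X Y Z : TopCat.{u}}

/-- The derived proper direct image `f_! = R f_(!) : D⁺(Y) ⥤ D⁺(X)`. -/
noncomputable abbrev derivedProperDirectImage
    [HasDerivedCategory.{w₁} (Sh Y)] [HasDerivedCategory.{w₂} (Sh X)] (f : Y ⟶ X) :
    DerivedCategory.Plus (Sh Y) ⥤ DerivedCategory.Plus (Sh X) :=
  (properDirectImage f).rightDerivedFunctorPlus

/-- The morphism `(f ∘ g)_! ⟶ f_! ∘ g_!` induced by the identity `f_(!) ∘ g_(!) = (f ∘ g)_(!)`,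
for `f` separated. -/
noncomputable def derivedProperDirectImageComparison
    [HasDerivedCategory.{w₁} (Sh Z)] [HasDerivedCategory.{w₂} (Sh Y)]
    [HasDerivedCategory.{w₃} (Sh X)] (g : Z ⟶ Y) (f : Y ⟶ X) (hf : IsSeparatedMap f) :
    derivedProperDirectImage (g ≫ f) ⟶ derivedProperDirectImage g ⋙ derivedProperDirectImage f :=
  DerivedPlus.rightDerivedComparison (properDirectImageComp g f hf)

end Sh

/-!
The sheaf `g_(!) F` is soft relative to `f` if `F` is injective: sections of flasque sheaves can
be cut off by extending them by zero outside a neighbourhood which is proper over the base. The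
functor `f_(!)` is exact on short exact sequences whose kernel is soft relative to `f`, and
quotients of soft sheaves by soft subsheaves are soft. Hence bounded below complexes of soft sheaves
compute `R f_(!)`, and `g_(!)` takes complexes of injective sheaves to such complexes, for which the
comparison morphism is therefore an isomorphism.
-/

namespace DerivedPlus

open Limits ZeroObject

section Acyclic

variable {B C : Type*} [Category* B] [Category* C] [Abelian B] [Abelian C]

lemma exact_of_epi_comp_of_comp_mono {S : ShortComplex B} (hS : S.Exact) {M N : B}
    {p : M ⟶ S.X₁} (hp : Epi p) {i : S.X₃ ⟶ N} (hi : Mono i) {f : M ⟶ S.X₂} {g : S.X₂ ⟶ N}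
    (hf : p ≫ S.f = f) (hg : S.g ≫ i = g) (w : f ≫ g = 0) : (ShortComplex.mk f g w).Exact := by
  subst hf hg
  let T : ShortComplex B := ShortComplex.mk (p ≫ S.f) S.g (by simp)
  let α : T ⟶ S := { τ₁ := p, τ₂ := 𝟙 _, τ₃ := 𝟙 _ }
  let β : T ⟶ ShortComplex.mk (p ≫ S.f) (S.g ≫ i) w := { τ₁ := 𝟙 _, τ₂ := 𝟙 _, τ₃ := i }
  have hT : T.Exact := (ShortComplex.exact_iff_of_epi_of_isIso_of_mono α).2 hS
  exact (ShortComplex.exact_iff_of_epi_of_isIso_of_mono β).1 hT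

/-- The sequence `Zⁱ(K) ⟶ Kⁱ ⟶ Zⁱ⁺¹(K)`, which is short exact when `K` is exact in
degree `i + 1`. -/
noncomputable abbrev cyclesShortComplex (K : CochainComplex B ℤ) (i : ℤ) : ShortComplex B :=
  ShortComplex.mk (K.iCycles i) (K.toCycles i (i + 1)) (by
    rw [← cancel_mono (K.iCycles (i + 1)), Category.assoc, K.toCycles_i, K.iCycles_d, zero_comp])

lemma shortExact_cyclesShortComplex {K : CochainComplex B ℤ} {i : ℤ} (hK : K.ExactAt (i + 1)) :
    (cyclesShortComplex K i).ShortExact where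
  exact := ShortComplex.exact_of_f_is_kernel _ (KernelFork.IsLimit.ofι' _ _ fun k hk ↦
    ⟨K.liftCycles k (i + 1) (by simp) (by rw [← K.toCycles_i, reassoc_of% hk, zero_comp]), by simp⟩)
  mono_f := inferInstanceAs (Mono (K.iCycles i))
  epi_g := Preadditive.epi_of_isZero_cokernel' _
    (K.homologyIsCokernel i (i + 1) (by simp)) hK.isZero_homology

lemma acyclic_map_of_shortExact_map {G : B ⥤ C} [G.Additive] {K : CochainComplex B ℤ}
    (h : ∀ i, ((cyclesShortComplex K i).map G).ShortExact) :
    ((G.mapHomologicalComplex (.up ℤ)).obj K).Acyclic := by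
  intro j
  obtain ⟨i, rfl⟩ : ∃ i, j = i + 1 := ⟨j - 1, by lia⟩
  rw [HomologicalComplex.exactAt_iff' _ i (i + 1) (i + 1 + 1) (by simp) (by simp)]
  have map_d (j : ℤ) : G.map (K.toCycles j (j + 1)) ≫ G.map (K.iCycles (j + 1)) =
      G.map (K.d j (j + 1)) := by
    rw [← G.map_comp, K.toCycles_i]
  exact exact_of_epi_comp_of_comp_mono (h (i + 1)).exact (h i).epi_g (h (i + 1 + 1)).mono_f
    (map_d i) (map_d (i + 1)) _

lemma quasiIso_quotient_map_iff_acyclic_mappingCone {K L : CochainComplex B ℤ} (φ : K ⟶ L) :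
    HomotopyCategory.quasiIso B (.up ℤ) ((HomotopyCategory.quotient B (.up ℤ)).map φ) ↔
      (CochainComplex.mappingCone φ).Acyclic := by
  rw [HomotopyCategory.quasiIso_eq_trW_subcategoryAcyclic]
  exact ((HomotopyCategory.subcategoryAcyclic B).trW_iff_of_distinguished _
      (HomotopyCategory.mappingCone_triangleh_distinguished φ)).trans
    (HomotopyCategory.quotient_obj_mem_subcategoryAcyclic_iff_acyclic _)

lemma quasiIso_map_quotient_map_iff_acyclic_map_mappingCone (G : B ⥤ C) [G.Additive]
    {K L : CochainComplex B ℤ} (φ : K ⟶ L) :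
    HomotopyCategory.quasiIso C (.up ℤ)
        ((G.mapHomotopyCategory (.up ℤ)).map ((HomotopyCategory.quotient B (.up ℤ)).map φ)) ↔
      ((G.mapHomologicalComplex (.up ℤ)).obj (CochainComplex.mappingCone φ)).Acyclic := by
  have e := CochainComplex.mappingCone.mapHomologicalComplexIso φ G
  exact (quasiIso_quotient_map_iff_acyclic_mappingCone ((G.mapHomologicalComplex _).map φ)).trans
    ⟨fun h i ↦ (h i).of_iso e.symm, fun h i ↦ (h i).of_iso e⟩

/-- A class of objects adapted to an additive functor `G`: `G` is exact on short exact sequences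
starting with an object of the class, and the class has the closure properties which are needed
in order to compute the right derived functor of `G` by complexes in the class. -/
structure IsAdapted (P : ObjectProperty B) (G : B ⥤ C) [G.Additive] : Prop where
  injective (I : B) [Injective I] : P I
  biprod (M N : B) : P M → P N → P (M ⊞ N)
  shortExact_map (S : ShortComplex B) : S.ShortExact → P S.X₁ → (S.map G).ShortExact
  quotient (S : ShortComplex B) : S.ShortExact → P S.X₁ → P S.X₂ → P S.X₃

namespace IsAdapted

variable {P : ObjectProperty B} {G : B ⥤ C} [G.Additive] (h : IsAdapted P G)
include h

lemma of_isZero {M : B} (hM : IsZero M) : P M :=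
  have := hM.injective
  h.injective M

lemma of_iso {M N : B} (e : M ≅ N) (hM : P M) : P N := by
  have hS : (ShortComplex.mk (0 : (0 : B) ⟶ M) e.hom zero_comp).ShortExact :=
    { exact := (ShortComplex.exact_iff_mono _ rfl).2 (inferInstanceAs (Mono e.hom))
      mono_f := ⟨fun _ _ _ ↦ (isZero_zero B).eq_of_tgt _ _⟩
      epi_g := inferInstanceAs (Epi e.hom) }
  exact h.quotient _ hS (h.of_isZero (isZero_zero B)) hM

lemma prop_cycles {K : CochainComplex B ℤ} (n : ℤ) [K.IsStrictlyGE n] (hK : K.Acyclic)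
    (hP : ∀ i, P (K.X i)) (i : ℤ) : P (K.cycles i) := by
  have prop_of_lt (i : ℤ) (hi : i < n) : P (K.cycles i) :=
    h.of_isZero (.of_mono (K.iCycles i) (K.isZero_of_isStrictlyGE n i hi))
  obtain hi | hi := lt_or_ge i (n - 1)
  · exact prop_of_lt i (by lia)
  · induction i, hi using Int.leInduction with
    | base => exact prop_of_lt _ (by lia)
    | succ i _ ih => exact h.quotient _ (shortExact_cyclesShortComplex (hK (i + 1))) ih (hP i)

lemma acyclic_map {K : CochainComplex B ℤ} (n : ℤ) [K.IsStrictlyGE n] (hK : K.Acyclic)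
    (hP : ∀ i, P (K.X i)) : ((G.mapHomologicalComplex (.up ℤ)).obj K).Acyclic :=
  acyclic_map_of_shortExact_map fun i ↦ h.shortExact_map _
    (shortExact_cyclesShortComplex (hK (i + 1))) (h.prop_cycles n hK hP i)

lemma prop_mappingCone_X {K L : CochainComplex B ℤ} (φ : K ⟶ L) (hK : ∀ i, P (K.X i))
    (hL : ∀ i, P (L.X i)) (i : ℤ) : P ((CochainComplex.mappingCone φ).X i) := by
  have := HomologicalComplex.HasHomotopyCofiber.hasBinaryBiproduct φ i (i + 1) rfl
  exact h.of_iso (HomologicalComplex.homotopyCofiber.XIsoBiprod φ i (i + 1) rfl).symm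
    (h.biprod _ _ (hK _) (hL _))

lemma quasiIso_map {K L : HomotopyCategory.Plus B} (φ : K ⟶ L)
    (hφ : HomotopyCategory.Plus.quasiIso B φ) (hK : ∀ i, P (K.obj.as.X i))
    (hL : ∀ i, P (L.obj.as.X i)) :
    HomotopyCategory.Plus.quasiIso C (G.mapHomotopyCategoryPlus.map φ) := by
  obtain ⟨⟨K, n, _⟩, rfl⟩ := HomotopyCategory.Plus.quotient_obj_surjective K
  obtain ⟨⟨L, m, _⟩, rfl⟩ := HomotopyCategory.Plus.quotient_obj_surjective L
  obtain ⟨⟨φ : K ⟶ L⟩, rfl⟩ := (HomotopyCategory.Plus.quotient B).map_surjective φ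
  have := CochainComplex.isStrictlyGE_mappingCone φ n m (min (n - 1) m)
  exact (quasiIso_map_quotient_map_iff_acyclic_map_mappingCone G φ).2
    (h.acyclic_map (min (n - 1) m) ((quasiIso_quotient_map_iff_acyclic_mappingCone φ).1 hφ)
      (h.prop_mappingCone_X φ hK hL))

variable [HasDerivedCategory B] [HasDerivedCategory C] [EnoughInjectives B]

lemma isIso_unit_app (K : HomotopyCategory.Plus B) (hK : ∀ i, P (K.obj.as.X i)) :
    IsIso (G.rightDerivedFunctorPlusUnit.app K) := by
  let r : (HomotopyCategory.Plus.localizerMorphism B).RightResolution K := Classical.arbitrary _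
  let I := (InjectiveObject.ι B).mapHomotopyCategoryPlus.obj r.X₁
  have hI (i : ℤ) : P (I.obj.as.X i) :=
    have : Injective (I.obj.as.X i) := (r.X₁.obj.as.X i).property
    h.injective _
  have isIso_Qh_map_w : IsIso (DerivedCategory.Plus.Qh.map r.w) :=
    Localization.inverts DerivedCategory.Plus.Qh _ _ r.hw
  have isIso_Qh_map_G_map_w :
      IsIso ((G.mapHomotopyCategoryPlus ⋙ DerivedCategory.Plus.Qh).map r.w) :=
    Localization.inverts DerivedCategory.Plus.Qh _ _ (h.quasiIso_map r.w r.hw hK hI)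
  have : IsIso (G.rightDerivedFunctorPlusUnit.app I) := inferInstance
  have : IsIso ((DerivedCategory.Plus.Qh ⋙ G.rightDerivedFunctorPlus).map r.w) :=
    inferInstanceAs (IsIso (G.rightDerivedFunctorPlus.map (DerivedCategory.Plus.Qh.map r.w)))
  exact @IsIso.of_isIso_fac_right _ _ _ _ _ _ _ _ this IsIso.comp_isIso
    (G.rightDerivedFunctorPlusUnit.naturality r.w).symm

end IsAdapted

end Acyclic

section CommShift

variable {C₁ C₂ C₃ D₁ D₂ D₃ : Type*} [Category* C₁] [Category* C₂] [Category* C₃] [Category* D₁]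
  [Category* D₂] [Category* D₃] {M : Type*} [AddMonoid M] [HasShift C₁ M] [HasShift C₂ M]
  [HasShift C₃ M] [HasShift D₁ M] [HasShift D₂ M] [HasShift D₃ M]

lemma commShift_of_whiskerLeft (L : C₁ ⥤ D₁) [L.EssSurj] [L.CommShift M] {F G : D₁ ⥤ D₂}
    [F.CommShift M] [G.CommShift M] (τ : F ⟶ G)
    [h : NatTrans.CommShift (Functor.whiskerLeft L τ) M] : NatTrans.CommShift τ M where
  shift_comm a := by
    ext X
    let i := L.objObjPreimageIso X
    let K := L.objPreimage X
    have hK : (F.commShiftIso a).hom.app (L.obj K) ≫ (τ.app (L.obj K))⟦a⟧' =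
        τ.app ((L.obj K)⟦a⟧) ≫ (G.commShiftIso a).hom.app (L.obj K) := by
      have := NatTrans.shift_app_comm (Functor.whiskerLeft L τ) a K
      rw [Functor.commShiftIso_comp_hom_app, Functor.commShiftIso_comp_hom_app,
        Functor.whiskerLeft_app, Functor.whiskerLeft_app, Category.assoc,
        ← τ.naturality_assoc] at this
      exact (cancel_epi _).1 this
    rw [← cancel_epi (F.map (i.hom⟦a⟧'))]
    have h₁ := (F.commShiftIso a).hom.naturality i.hom
    have h₂ := (G.commShiftIso a).hom.naturality i.hom
    dsimp at h₁ h₂ ⊢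
    rw [reassoc_of% h₁, ← Functor.map_comp, τ.naturality, τ.naturality_assoc, h₂,
      Functor.map_comp, reassoc_of% hK]

lemma commShift_of_whiskerRight (L : D₂ ⥤ C₂) [L.Faithful] [L.CommShift M] {F G : D₁ ⥤ D₂}
    [F.CommShift M] [G.CommShift M] (τ : F ⟶ G)
    [h : NatTrans.CommShift (Functor.whiskerRight τ L) M] : NatTrans.CommShift τ M where
  shift_comm a := by
    ext X
    apply L.map_injective
    rw [← cancel_mono ((L.commShiftIso a).hom.app _)]
    have := NatTrans.shift_app_comm (Functor.whiskerRight τ L) a X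
    rw [Functor.commShiftIso_comp_hom_app, Functor.commShiftIso_comp_hom_app] at this
    have h₁ := (L.commShiftIso a).hom.naturality (τ.app X)
    dsimp at this h₁ ⊢
    rw [Functor.map_comp, Functor.map_comp, Category.assoc, Category.assoc, h₁, ← this,
      Category.assoc]

variable {L₁ : C₁ ⥤ D₁} {L₂ : C₂ ⥤ D₂} {L₃ : C₃ ⥤ D₃} {F : C₁ ⥤ C₂} {G : C₂ ⥤ C₃} {H : C₁ ⥤ C₃}
  {F' : D₁ ⥤ D₂} {G' : D₂ ⥤ D₃} {H' : D₁ ⥤ D₃}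
  [L₁.CommShift M] [L₂.CommShift M] [L₃.CommShift M]
  [F.CommShift M] [G.CommShift M] [H.CommShift M]
  [F'.CommShift M] [G'.CommShift M] [H'.CommShift M]
  (φ : F ⋙ L₂ ≅ L₁ ⋙ F') (γ : G ⋙ L₃ ≅ L₂ ⋙ G') (η : H ⋙ L₃ ≅ L₁ ⋙ H')
  [NatTrans.CommShift φ.hom M] [NatTrans.CommShift γ.hom M] [NatTrans.CommShift η.hom M]
  (τ : F ⋙ G ⟶ H) (τ' : F' ⋙ G' ⟶ H')
  (fac : ∀ X, γ.hom.app (F.obj X) ≫ G'.map (φ.hom.app X) ≫ τ'.app (L₁.obj X) =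
    L₃.map (τ.app X) ≫ η.hom.app X)
include φ γ η fac

lemma commShift_of_square_of_essSurj [L₁.EssSurj] [NatTrans.CommShift τ M] :
    NatTrans.CommShift τ' M := by
  have : Functor.whiskerLeft L₁ τ' =
      (Functor.associator _ _ _).inv ≫ Functor.whiskerRight φ.inv G' ≫
      (Functor.associator _ _ _).hom ≫ Functor.whiskerLeft F γ.inv ≫
      (Functor.associator _ _ _).inv ≫ Functor.whiskerRight τ L₃ ≫ η.hom := by
    ext X
    have h := fac X
    dsimp
    simp only [Category.id_comp]
    rw [← h, Iso.inv_hom_id_app_assoc, ← Functor.map_comp_assoc, Iso.inv_hom_id_app]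
    simp
  have : NatTrans.CommShift (Functor.whiskerLeft L₁ τ') M := by
    rw [this]
    infer_instance
  exact commShift_of_whiskerLeft L₁ τ'

lemma commShift_of_square_of_faithful [L₃.Faithful] [NatTrans.CommShift τ' M] :
    NatTrans.CommShift τ M := by
  have : Functor.whiskerRight τ L₃ =
      (Functor.associator _ _ _).hom ≫ Functor.whiskerLeft F γ.hom ≫
      (Functor.associator _ _ _).inv ≫ Functor.whiskerRight φ.hom G' ≫
      (Functor.associator _ _ _).hom ≫ Functor.whiskerLeft L₁ τ' ≫ η.inv := by
    ext X
    have h := fac X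
    dsimp
    simp only [Category.id_comp]
    rw [reassoc_of% h, Iso.hom_inv_id_app]
    simp
  have : NatTrans.CommShift (Functor.whiskerRight τ L₃) M := by
    rw [this]
    infer_instance
  exact commShift_of_whiskerRight L₃ τ

end CommShift

variable {A B C : Type*} [Category* A] [Category* B] [Category* C] [Abelian A] [Abelian B]
  [Abelian C] {F : A ⥤ B} [F.Additive] {G : B ⥤ C} [G.Additive] {H : A ⥤ C} [H.Additive]
  (e : F ⋙ G ≅ H)

instance commShift_mapHomologicalComplexCompIso :
    NatTrans.CommShift (Functor.mapHomologicalComplexCompIso e (.up ℤ)).hom ℤ where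
  shift_comm a := by
    ext K i
    rw [NatTrans.comp_app, NatTrans.comp_app, Functor.commShiftIso_comp_hom_app]
    exact ((congrArg (· ≫ _) ((congrArg (· ≫ _) (G.map_id _)).trans (Category.id_comp _))).trans
        (Category.id_comp _)).trans (Category.comp_id _).symm

instance commShift_mapHomotopyCategoryCompIso :
    NatTrans.CommShift (Functor.mapHomotopyCategoryCompIso e (.up ℤ)).hom ℤ :=
  commShift_of_square_of_essSurj (F.mapHomotopyCategoryFactors (.up ℤ)).symm
    (G.mapHomotopyCategoryFactors (.up ℤ)).symm (H.mapHomotopyCategoryFactors (.up ℤ)).symm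
    (Functor.mapHomologicalComplexCompIso e (.up ℤ)).hom _ (fun _ ↦
      (Category.id_comp _).trans
        (((congrArg (· ≫ _) (CategoryTheory.Functor.map_id _ _)).trans
          (Category.id_comp _)).trans (Category.comp_id _).symm))

variable (F) in
/-- The functor induced by `F` between the bounded below homotopy categories is induced by the
functor between the homotopy categories. -/
def mapHomotopyCategoryPlusCompι : F.mapHomotopyCategoryPlus ⋙ HomotopyCategory.Plus.ι B ≅
    HomotopyCategory.Plus.ι A ⋙ F.mapHomotopyCategory (.up ℤ) :=
  (HomotopyCategory.plus B).liftCompιIso _ _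

instance : NatTrans.CommShift (mapHomotopyCategoryPlusCompι F).hom ℤ :=
  Functor.CommShift.ofComp_compatibility (F := F.mapHomotopyCategoryPlus)
    (mapHomotopyCategoryPlusCompι F) ℤ

instance commShift_mapHomotopyCategoryPlusCompIso :
    NatTrans.CommShift (Functor.mapHomotopyCategoryPlusCompIso e).hom ℤ :=
  commShift_of_square_of_faithful (mapHomotopyCategoryPlusCompι F)
    (mapHomotopyCategoryPlusCompι G) (mapHomotopyCategoryPlusCompι H) _
    (Functor.mapHomotopyCategoryCompIso e (.up ℤ)).hom (fun _ ↦
      (Category.id_comp _).trans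
        (((congrArg (· ≫ _) (CategoryTheory.Functor.map_id _ _)).trans
          (Category.id_comp _)).trans (Category.comp_id _).symm))

variable [HasDerivedCategory A] [HasDerivedCategory B] [HasDerivedCategory C]
  [EnoughInjectives A] [EnoughInjectives B]

/-- The natural transformation `H(K) ≅ G(F(K)) ⟶ RG(F(K)) ⟶ RG(RF(K))` through which
`rightDerivedComparison` is defined. The associators are identities; they let the instances on
compatibility with shifts be found. -/
noncomputable abbrev compositeUnit : H.mapHomotopyCategoryPlus ⋙ DerivedCategory.Plus.Qh ⟶
    DerivedCategory.Plus.Qh ⋙ F.rightDerivedFunctorPlus ⋙ G.rightDerivedFunctorPlus :=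
  Functor.whiskerRight (Functor.mapHomotopyCategoryPlusCompIso e).inv DerivedCategory.Plus.Qh ≫
    (Functor.associator _ _ _).hom ≫
    Functor.whiskerLeft F.mapHomotopyCategoryPlus G.rightDerivedFunctorPlusUnit ≫
    (Functor.associator _ _ _).inv ≫
    Functor.whiskerRight F.rightDerivedFunctorPlusUnit G.rightDerivedFunctorPlus ≫
    (Functor.associator _ _ _).hom

lemma unit_app_comp_rightDerivedComparison_app (K : HomotopyCategory.Plus A) :
    H.rightDerivedFunctorPlusUnit.app K ≫
        (rightDerivedComparison e).app (DerivedCategory.Plus.Qh.obj K) =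
      (compositeUnit e).app K := by
  refine (H.rightDerivedFunctorPlus.rightDerived_fac_app H.rightDerivedFunctorPlusUnit
    (HomotopyCategory.Plus.quasiIso A) _ _ K).trans ?_
  simp

theorem isIso_rightDerivedComparison {P : ObjectProperty B} (hP : IsAdapted P G)
    (hF : ∀ (I : A) [Injective I], P (F.obj I)) : IsIso (rightDerivedComparison e) := by
  rw [NatTrans.isIso_iff_isIso_app]
  intro M
  let L := (injectiveToDerived A).objPreimage M
  let K := (InjectiveObject.ι A).mapHomotopyCategoryPlus.obj L
  let i : DerivedCategory.Plus.Qh.obj K ≅ M := (injectiveToDerived A).objObjPreimageIso M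
  rw [← NatTrans.isIso_app_iff_of_iso _ i]
  have (n : ℤ) : Injective (K.obj.as.X n) := (L.obj.as.X n).property
  have : IsIso (G.rightDerivedFunctorPlusUnit.app (F.mapHomotopyCategoryPlus.obj K)) :=
    hP.isIso_unit_app _ fun n ↦ hF (K.obj.as.X n)
  have : IsIso ((compositeUnit e).app K) := by
    dsimp
    infer_instance
  have : IsIso (H.rightDerivedFunctorPlusUnit.app K) := inferInstance
  exact IsIso.of_isIso_fac_left (unit_app_comp_rightDerivedComparison_app e K)

instance commShift_rightDerivedComparison :
    NatTrans.CommShift (rightDerivedComparison e) ℤ := by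
  let I := (InjectiveObject.ι A).mapHomotopyCategoryPlus
  have fac : Functor.whiskerLeft (injectiveToDerived A) (rightDerivedComparison e) =
      (injectiveIso H).hom ≫ Functor.whiskerLeft I (compositeUnit e) ≫
        (Functor.associator _ _ _).inv := by
    rw [← Iso.inv_comp_eq]
    refine NatTrans.ext (funext fun K ↦ ?_)
    exact (unit_app_comp_rightDerivedComparison_app e (I.obj K)).trans (Category.comp_id _).symm
  have := commShift_injectiveIso H
  have : NatTrans.CommShift
      (Functor.whiskerLeft (injectiveToDerived A) (rightDerivedComparison e)) ℤ := by
    rw [fac]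
    infer_instance
  exact commShift_of_whiskerLeft (injectiveToDerived A) _

end DerivedPlus

section Topology

variable {Y X : Type*} [TopologicalSpace Y] {f : Y → X} {x : X} {K L : Set Y}

lemma isCompact_inter_of_isSeparatedMap (hf : IsSeparatedMap f) (hK : IsCompact K)
    (hL : IsCompact L) (hKx : K ⊆ f ⁻¹' {x}) (hLx : L ⊆ f ⁻¹' {x}) : IsCompact (K ∩ L) := by
  rw [isCompact_iff_ultrafilter_le_nhds] at *
  intro 𝒰 h
  obtain ⟨y, hy, hle⟩ := hK 𝒰 (h.trans (Filter.principal_mono.2 Set.inter_subset_left))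
  obtain ⟨z, hz, hle'⟩ := hL 𝒰 (h.trans (Filter.principal_mono.2 Set.inter_subset_right))
  obtain rfl : y = z := by
    by_contra hn
    have hd := isSeparatedMap_iff_disjoint_nhds.1 hf y z ((hKx hy).trans (hLx hz).symm) hn
    exact 𝒰.neBot.ne (le_bot_iff.1 (hd hle hle'))
  exact ⟨y, ⟨hy, hz⟩, hle⟩

lemma exists_opens_inf_le_of_isSeparatedMap (hf : IsSeparatedMap f) (hK : IsCompact K)
    (hL : IsCompact L) (hKx : K ⊆ f ⁻¹' {x}) (hLx : L ⊆ f ⁻¹' {x}) {W : Opens Y}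
    (h : K ∩ L ⊆ W) : ∃ N M : Opens Y, K ⊆ N ∧ L ⊆ M ∧ N ⊓ M ≤ W := by
  have hd : Disjoint (𝓝ˢ (K \ W)) (𝓝ˢ (L \ W)) := by
    rw [(hK.diff W.isOpen).disjoint_nhdsSet_left]
    intro a ha
    rw [(hL.diff W.isOpen).disjoint_nhdsSet_right]
    intro b hb
    refine isSeparatedMap_iff_disjoint_nhds.1 hf a b ((hKx ha.1).trans (hLx hb.1).symm) ?_
    rintro rfl
    exact ha.2 (h ⟨ha.1, hb.1⟩)
  obtain ⟨N, M, hN, hM, hKN, hLM, hNM⟩ := separatedNhds_iff_disjoint.2 hd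
  refine ⟨W ⊔ ⟨N, hN⟩, W ⊔ ⟨M, hM⟩, Set.sdiff_subset_iff.1 hKN, Set.sdiff_subset_iff.1 hLM, ?_⟩
  rw [← sup_inf_left]
  exact sup_le le_rfl fun y hy ↦ (Set.disjoint_left.1 hNM hy.1 hy.2).elim

variable [TopologicalSpace X] {A B : Set Y} {U V : Set X}

/-- A subset `A` of `Y` is proper over a subset `U` of `X`: if the images under `f` of an
ultrafilter on `A` converge to a point `x` of `U`, then it converges to a point of `A` over `x`. -/
def ProperOver (f : Y → X) (A : Set Y) (U : Set X) : Prop :=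
  ∀ 𝒰 : Ultrafilter Y, A ∈ 𝒰 → ∀ x ∈ U, Filter.Tendsto f 𝒰 (𝓝 x) → ∃ y ∈ A, f y = x ∧ ↑𝒰 ≤ 𝓝 y

namespace ProperOver

lemma of_isProperMap (h : Set.MapsTo f A U) (hp : IsProperMap (h.restrict f A U)) :
    ProperOver f A U := by
  intro 𝒰 hA x hx hf
  have hr : Set.range (Subtype.val : A → Y) ∈ 𝒰 := by rwa [Subtype.range_coe]
  let 𝒱 : Ultrafilter A := 𝒰.comap Subtype.val_injective hr
  have hmap : Filter.map Subtype.val (𝒱 : Filter A) = 𝒰 := by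
    rw [Ultrafilter.coe_comap, Filter.map_comap_of_mem hr]
  obtain ⟨y, hy, hle⟩ := (isProperMap_iff_ultrafilter.1 hp).2 (𝒰 := 𝒱) (y := ⟨x, hx⟩) (by
    rw [tendsto_subtype_rng]
    change Filter.Tendsto (f ∘ Subtype.val) (𝒱 : Filter A) (𝓝 x)
    rwa [← Filter.tendsto_map'_iff, hmap])
  refine ⟨y, y.2, congrArg Subtype.val hy, ?_⟩
  rw [← hmap]
  exact (Filter.map_mono hle).trans continuous_subtype_val.continuousAt

lemma empty (f : Y → X) (U : Set X) : ProperOver f ∅ U :=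
  fun 𝒰 h ↦ (𝒰.empty_notMem h).elim

lemma union (hA : ProperOver f A U) (hB : ProperOver f B U) : ProperOver f (A ∪ B) U := by
  intro 𝒰 h x hx hf
  rcases Ultrafilter.union_mem_iff.1 h with h | h
  · obtain ⟨y, hy, e⟩ := hA 𝒰 h x hx hf
    exact ⟨y, .inl hy, e⟩
  · obtain ⟨y, hy, e⟩ := hB 𝒰 h x hx hf
    exact ⟨y, .inr hy, e⟩

lemma mono (hA : ProperOver f A U) (hVU : V ⊆ U) : ProperOver f A V :=
  fun 𝒰 h x hx ↦ hA 𝒰 h x (hVU hx)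

lemma of_subset (hA : ProperOver f A U) (hBA : B ⊆ A)
    (hB : ∀ y ∈ closure B, f y ∈ U → y ∈ B) : ProperOver f B U := by
  intro 𝒰 h x hx hf
  obtain ⟨y, -, rfl, hle⟩ := hA 𝒰 (Filter.mem_of_superset h hBA) x hx hf
  exact ⟨y, hB y (mem_closure_iff_ultrafilter.2 ⟨𝒰, h, hle⟩) hx, rfl, hle⟩

lemma inter_preimage {Z : Type*} [TopologicalSpace Z] {g : Z → Y} {S : Set Z} {T : Set Y}
    (hS : ProperOver g S T) (hA : ProperOver f A U) (hAT : A ⊆ T) :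
    ProperOver (f ∘ g) (S ∩ g ⁻¹' A) U := by
  intro 𝒰 h x hx hlim
  obtain ⟨y, hy, hyx, hle⟩ := hA (𝒰.map g)
    (show g ⁻¹' A ∈ 𝒰 from Filter.mem_of_superset h Set.inter_subset_right) x hx
    (by rwa [Ultrafilter.coe_map, Filter.tendsto_map'_iff])
  obtain ⟨z, hz, rfl, hle'⟩ :=
    hS 𝒰 (Filter.mem_of_superset h Set.inter_subset_left) y (hAT hy) hle
  exact ⟨z, ⟨hz, hy⟩, hyx, hle'⟩

lemma mem_of_mem_closure (hA : ProperOver f A U) (hc : Continuous f) (hf : IsSeparatedMap f) {y : Y}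
    (hy : y ∈ closure A) (hyU : f y ∈ U) : y ∈ A := by
  obtain ⟨𝒰, h, hle⟩ := mem_closure_iff_ultrafilter.1 hy
  obtain ⟨z, hz, e, hle'⟩ := hA 𝒰 h (f y) hyU ((hc.tendsto y).mono_left hle)
  by_contra hn
  have hd := isSeparatedMap_iff_disjoint_nhds.1 hf z y e (fun h ↦ hn (h ▸ hz))
  exact 𝒰.neBot.ne (le_bot_iff.1 (hd hle' hle))

protected lemma frontier (hA : ProperOver f A U) (hc : Continuous f) (hf : IsSeparatedMap f)
    (hU : IsOpen U) : ProperOver f (frontier A) U := by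
  intro 𝒰 h x hx hlim
  have hAU : A ∈ 𝒰 := by
    filter_upwards [h, hlim (hU.mem_nhds hx)] with y hy hyU
    exact hA.mem_of_mem_closure hc hf (frontier_subset_closure hy) hyU
  obtain ⟨y, -, hyx, hle⟩ := hA 𝒰 hAU x hx hlim
  exact ⟨y, isClosed_frontier.mem_of_frequently_of_tendsto
    (Filter.Eventually.frequently h) hle, hyx, hle⟩

lemma isCompact_inter_fiber (hA : ProperOver f A U) (hx : x ∈ U) :
    IsCompact (A ∩ f ⁻¹' {x}) := by
  rw [isCompact_iff_ultrafilter_le_nhds]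
  intro 𝒰 h
  rw [Filter.le_principal_iff] at h
  obtain ⟨y, hy, e, hle⟩ := hA 𝒰 (Filter.mem_of_superset h Set.inter_subset_left) x hx
    (tendsto_const_nhds.congr' (Filter.mem_of_superset h fun z hz ↦ hz.2.symm))
  exact ⟨y, ⟨hy, e⟩, hle⟩

lemma exists_inter_preimage_subset (hA : ProperOver f A U) (hx : x ∈ U) {N : Set Y}
    (hN : IsOpen N) (h : A ∩ f ⁻¹' {x} ⊆ N) : ∃ V : Opens X, x ∈ V ∧ A ∩ f ⁻¹' V ⊆ N := by
  have hd : Disjoint (Filter.comap f (𝓝 x)) (Filter.principal (A \ N)) := by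
    rw [disjoint_iff]
    by_contra hne
    have : (Filter.comap f (𝓝 x) ⊓ Filter.principal (A \ N)).NeBot := ⟨hne⟩
    obtain ⟨𝒱, h𝒱⟩ := Ultrafilter.exists_le (Filter.comap f (𝓝 x) ⊓ Filter.principal (A \ N))
    have hs : A \ N ∈ 𝒱 := Filter.le_principal_iff.1 (h𝒱.trans inf_le_right)
    obtain ⟨y, hy, e, hle⟩ := hA 𝒱 (Filter.mem_of_superset hs Set.sdiff_subset) x hx
      (Filter.tendsto_iff_comap.2 (h𝒱.trans inf_le_left))
    obtain ⟨z, hz, hzN⟩ := 𝒱.nonempty_of_mem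
      (Filter.inter_mem hs (hle (hN.mem_nhds (h ⟨hy, e⟩))))
    exact hz.2 hzN
  rw [Filter.disjoint_principal_right, Filter.mem_comap] at hd
  obtain ⟨T, hT, hTN⟩ := hd
  obtain ⟨V, hVT, hV, hxV⟩ := mem_nhds_iff.1 hT
  refine ⟨⟨V, hV⟩, hxV, fun y hy ↦ ?_⟩
  by_contra hn
  exact hTN (hVT hy.2) ⟨hy.1, hn⟩

end ProperOver

namespace IsLocallyProper

lemma exists_properOver (hf : IsLocallyProper f) (hK : IsCompact K) (hKx : K ⊆ f ⁻¹' {x})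
    {V : Set Y} (hV : IsOpen V) (hKV : K ⊆ V) :
    ∃ (A : Set Y) (U : Opens X), A ⊆ V ∧ K ⊆ interior A ∧ x ∈ U ∧ ProperOver f A U := by
  refine hK.induction_on (p := fun S ↦ ∃ (A : Set Y) (U : Opens X), A ⊆ V ∧ S ⊆ interior A ∧
    x ∈ U ∧ ProperOver f A U) ?_ ?_ ?_ ?_
  · exact ⟨∅, ⊤, Set.empty_subset _, Set.empty_subset _, Set.mem_univ _, .empty f _⟩
  · rintro S T hST ⟨A, U, hAV, hTA, hx, hA⟩
    exact ⟨A, U, hAV, hST.trans hTA, hx, hA⟩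
  · rintro S T ⟨A, U, hAV, hSA, hxU, hA⟩ ⟨B, U', hBV, hTB, hxU', hB⟩
    exact ⟨A ∪ B, U ⊓ U', Set.union_subset hAV hBV,
      (Set.union_subset_union hSA hTB).trans subset_interior_union, ⟨hxU, hxU'⟩,
      (hA.mono inf_le_left).union (hB.mono inf_le_right)⟩
  · intro y hy
    obtain ⟨A, hA, U, hU, hAV, h, hp⟩ := hf.2 y V (hV.mem_nhds (hKV hy))
    rw [show f y = x from hKx hy] at hU
    exact ⟨interior A, mem_nhdsWithin_of_mem_nhds (interior_mem_nhds.2 hA), A,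
      ⟨interior U, isOpen_interior⟩, hAV, le_rfl, mem_interior_iff_mem_nhds.2 hU,
      (ProperOver.of_isProperMap h hp).mono interior_subset⟩

lemma exists_isCompact_subset_fiber (hf : IsLocallyProper f) {y : Y} (hy : f y = x) {V : Set Y}
    (hV : V ∈ 𝓝 y) : ∃ L : Set Y, IsCompact L ∧ L ⊆ V ∧ L ⊆ f ⁻¹' {x} ∧ L ∈ 𝓝[f ⁻¹' {x}] y := by
  obtain ⟨A, hA, U, hU, hAV, h, hp⟩ := hf.2 y V hV
  rw [hy] at hU
  exact ⟨A ∩ f ⁻¹' {x}, (ProperOver.of_isProperMap h hp).isCompact_inter_fiber (mem_of_mem_nhds hU),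
    Set.inter_subset_left.trans hAV, Set.inter_subset_right,
    Filter.inter_mem (mem_nhdsWithin_of_mem_nhds hA) self_mem_nhdsWithin⟩

end IsLocallyProper

end Topology

namespace Sh

open Limits

variable {Y : TopCat.{u}}

/-- The restriction of sections of a sheaf to a smaller open subset. -/
def res (F : Sh Y) {V W : Opens Y} (h : W ≤ V) :
    F.presheaf.obj (op V) →+ F.presheaf.obj (op W) :=
  (F.presheaf.map (homOfLE h).op).hom

/-- The homomorphism on sections over `V` given by a morphism of sheaves. -/
def onSections {F G : Sh Y} (φ : F ⟶ G) (V : Opens Y) :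
    F.presheaf.obj (op V) →+ G.presheaf.obj (op V) :=
  (φ.1.app (op V)).hom

@[simp]
lemma res_res (F : Sh Y) {V W T : Opens Y} (h : W ≤ V) (h' : T ≤ W) (s : F.presheaf.obj (op V)) :
    res F h' (res F h s) = res F (h'.trans h) s :=
  (ConcreteCategory.congr_hom (F.presheaf.map_comp (homOfLE h).op (homOfLE h').op) s).symm

@[simp]
lemma res_self (F : Sh Y) {V : Opens Y} (s : F.presheaf.obj (op V)) :
    res F le_rfl s = s :=
  ConcreteCategory.congr_hom (F.presheaf.map_id (op V)) s

lemma onSections_res {F G : Sh Y} (φ : F ⟶ G) {V W : Opens Y} (h : W ≤ V)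
    (s : F.presheaf.obj (op V)) : onSections φ W (res F h s) = res G h (onSections φ V s) :=
  ConcreteCategory.congr_hom (φ.1.naturality (homOfLE h).op) s

lemma notMem_supp_iff_res (F : Sh Y) {V : Opens Y} (s : F.presheaf.obj (op V)) {y : Y}
    (hy : y ∈ V) : y ∉ supp F s ↔ ∃ W : Opens Y, y ∈ W ∧ ∃ h : W ≤ V, res F h s = 0 :=
  (notMem_supp_iff F s y hy).trans
    ⟨fun ⟨W, hW, i, e⟩ ↦ ⟨W, hW, i.le, e⟩, fun ⟨W, hW, h, e⟩ ↦ ⟨W, hW, homOfLE h, e⟩⟩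

lemma res_eq_zero_iff (F : Sh Y) {V W : Opens Y} (h : W ≤ V) (s : F.presheaf.obj (op V)) :
    res F h s = 0 ↔ Disjoint (supp F s) W := by
  constructor
  · intro h0
    rw [Set.disjoint_left]
    intro y hy hyW
    exact (notMem_supp_iff_res F s (h hyW)).2 ⟨W, hyW, h, h0⟩ hy
  · intro hd
    by_contra hne
    obtain ⟨y, hyW, hy⟩ := exists_of_mem_nhds F (homOfLE h) s hne
    exact Set.disjoint_left.1 hd hy hyW

lemma supp_res (F : Sh Y) {V W : Opens Y} (h : W ≤ V) (s : F.presheaf.obj (op V)) :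
    supp F (res F h s) = supp F s ∩ W :=
  supp_map F (homOfLE h) s

/-- The open set of the points of `V` near which a section over `V` vanishes. -/
def vanishing (F : Sh Y) {V : Opens Y} (s : F.presheaf.obj (op V)) : Opens Y where
  carrier := V \ supp F s
  is_open' := by
    refine isOpen_iff_mem_nhds.2 fun y hy ↦ ?_
    obtain ⟨W, hyW, h, h0⟩ := (notMem_supp_iff_res F s hy.1).1 hy.2
    exact Filter.mem_of_superset (W.isOpen.mem_nhds hyW) fun z hz ↦
      ⟨h hz, (notMem_supp_iff_res F s (h hz)).2 ⟨W, hz, h, h0⟩⟩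

lemma vanishing_le (F : Sh Y) {V : Opens Y} (s : F.presheaf.obj (op V)) : vanishing F s ≤ V :=
  fun _ hy ↦ hy.1

lemma res_eq_zero_iff_le_vanishing (F : Sh Y) {V W : Opens Y} (h : W ≤ V)
    {s : F.presheaf.obj (op V)} : res F h s = 0 ↔ W ≤ vanishing F s := by
  rw [res_eq_zero_iff, Set.disjoint_right]
  exact ⟨fun hs y hy ↦ ⟨h hy, hs hy⟩, fun hs y hy ↦ (hs hy).2⟩

lemma res_vanishing (F : Sh Y) {V : Opens Y} (s : F.presheaf.obj (op V)) :
    res F (vanishing_le F s) s = 0 :=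
  (res_eq_zero_iff_le_vanishing F _).2 le_rfl

lemma section_ext₂ (F : Sh Y) {V V₁ V₂ : Opens Y} (h₁ : V₁ ≤ V) (h₂ : V₂ ≤ V) (hV : V ≤ V₁ ⊔ V₂)
    {s t : F.presheaf.obj (op V)} (e₁ : res F h₁ s = res F h₁ t) (e₂ : res F h₂ s = res F h₂ t) :
    s = t :=
  F.eq_of_locally_eq₂ (homOfLE h₁) (homOfLE h₂) hV s t e₁ e₂

lemma exists_glue₂ (F : Sh Y) {V V₁ V₂ : Opens Y} (h₁ : V₁ ≤ V) (h₂ : V₂ ≤ V) (hV : V ≤ V₁ ⊔ V₂)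
    (s₁ : F.presheaf.obj (op V₁)) (s₂ : F.presheaf.obj (op V₂))
    (e : res F (inf_le_left : V₁ ⊓ V₂ ≤ V₁) s₁ = res F (inf_le_right : V₁ ⊓ V₂ ≤ V₂) s₂) :
    ∃ s : F.presheaf.obj (op V), res F h₁ s = s₁ ∧ res F h₂ s = s₂ := by
  let U : Bool → Opens Y := fun b ↦ bif b then V₁ else V₂
  let sf : ∀ b, F.presheaf.obj (op (U b)) := fun b ↦ match b with
    | true => s₁
    | false => s₂
  obtain ⟨s, hs, -⟩ := F.existsUnique_gluing' U V
    (fun b ↦ homOfLE (match b with | true => h₁ | false => h₂))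
    (hV.trans (sup_le (le_iSup U true) (le_iSup U false))) sf (by
      rintro (_ | _) (_ | _)
      · rfl
      · have := congrArg (res F (inf_comm V₁ V₂).ge) e
        rw [res_res, res_res] at this
        exact this.symm
      · exact e
      · rfl)
  exact ⟨s, hs true, hs false⟩

lemma onSections_injective {F G : Sh Y} (φ : F ⟶ G) [Mono φ] (V : Opens Y) :
    Function.Injective (onSections φ V) := by
  have h : Mono ((TopCat.Sheaf.forget _ _).map φ) := inferInstance
  have h' : Mono (((TopCat.Sheaf.forget _ _).map φ).app (op V)) := inferInstance
  exact (AddCommGrpCat.mono_iff_injective _).1 h'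

lemma supp_onSections_of_mono {F G : Sh Y} (φ : F ⟶ G) [Mono φ] {V : Opens Y}
    (s : F.presheaf.obj (op V)) : supp G (onSections φ V s) = supp F s := by
  refine Set.Subset.antisymm (supp_app φ s) fun y hy ↦ ?_
  by_contra hn
  obtain ⟨W, hyW, h, h0⟩ := (notMem_supp_iff_res G _ (supp_subset F s hy)).1 hn
  rw [← onSections_res] at h0
  refine (notMem_supp_iff_res F s (supp_subset F s hy)).2 ⟨W, hyW, h, ?_⟩ hy
  exact onSections_injective φ W (h0.trans (map_zero _).symm)

lemma mono_of_onSections_injective {F G : Sh Y} (φ : F ⟶ G)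
    (h : ∀ V, Function.Injective (onSections φ V)) : Mono φ := by
  have : Mono ((TopCat.Sheaf.forget _ _).map φ) := by
    have (V : (Opens Y)ᵒᵖ) : Mono (((TopCat.Sheaf.forget _ _).map φ).app V) :=
      (AddCommGrpCat.mono_iff_injective _).2 (h V.unop)
    exact NatTrans.mono_of_mono_app _
  exact (TopCat.Sheaf.forget _ _).mono_of_mono_map this

lemma epi_iff_locally_surjective {F G : Sh Y} (φ : F ⟶ G) :
    Epi φ ↔ ∀ (V : Opens Y) (t : G.presheaf.obj (op V)), ∀ y ∈ V, ∃ (W : Opens Y) (h : W ≤ V),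
      y ∈ W ∧ ∃ s : F.presheaf.obj (op W), onSections φ W s = res G h t := by
  rw [← TopCat.Sheaf.isLocallySurjective_iff_epi, TopCat.Presheaf.isLocallySurjective_iff]
  exact forall₄_congr fun _ _ _ _ ↦ exists₂_congr fun _ _ ↦ and_comm

lemma exact_of_onSections (S : ShortComplex (Sh Y))
    (h : ∀ (V : Opens Y) (s : S.X₂.presheaf.obj (op V)), onSections S.g V s = 0 →
      ∃ t, onSections S.f V t = s) : S.Exact := by
  rw [S.exact_iff_epi_kernel_lift, epi_iff_locally_surjective]
  intro V k y hy
  have comp {F G H : Sh Y} (φ : F ⟶ G) (ψ : G ⟶ H) (s : F.presheaf.obj (op V)) :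
    onSections ψ V (onSections φ V s) = onSections (φ ≫ ψ) V s := rfl
  obtain ⟨t, ht⟩ := h V (onSections (kernel.ι S.g) V k) (by
    rw [comp, kernel.condition]; rfl)
  refine ⟨V, le_rfl, hy, t, onSections_injective (kernel.ι S.g) V ?_⟩
  rw [comp, kernel.lift_ι, ht, res_self]

lemma exists_of_onSections_eq_zero {S : ShortComplex (Sh Y)} (hS : S.ShortExact)
    {V : Opens Y} (s : S.X₂.presheaf.obj (op V)) (h : onSections S.g V s = 0) :
    ∃ t, onSections S.f V t = s :=
  TopCat.Sheaf.sections_exact_of_left_exact hS.exact hS.mono_f s h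

lemma onSections_g_onSections_f (S : ShortComplex (Sh Y)) {V : Opens Y}
    (s : S.X₁.presheaf.obj (op V)) : onSections S.g V (onSections S.f V s) = 0 :=
  ConcreteCategory.congr_hom (congrArg (fun φ ↦ φ.1.app (op V)) S.zero) s

section Flasque

lemma map_surjective_of_injective {C : Type u} [SmallCategory C] {J : GrothendieckTopology C}
    (F : Sheaf J AddCommGrpCat.{u}) [Injective F] {V W : C} (i : W ⟶ V) [Mono i] :
    Function.Surjective (F.obj.map i.op) := by
  let free : (Cᵒᵖ ⥤ Type u) ⥤ Sheaf J AddCommGrpCat.{u} :=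
    (Functor.whiskeringRight _ _ _).obj AddCommGrpCat.free ⋙ presheafToSheaf J _
  let adj : free ⊣ _ :=
    (AddCommGrpCat.adj.whiskerRight Cᵒᵖ).comp (sheafificationAdjunction J AddCommGrpCat.{u})
  have mono_free_map : Mono (free.map (yoneda.map i)) := by
    let free' := (Functor.whiskeringRight Cᵒᵖ _ _).obj AddCommGrpCat.free.{u}
    have (U : Cᵒᵖ) : Mono ((free'.map (yoneda.map i)).app U) :=
      inferInstanceAs (Mono (AddCommGrpCat.free.map ((yoneda.map i).app U)))
    have : Mono (free'.map (yoneda.map i)) := NatTrans.mono_of_mono_app _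
    exact inferInstanceAs (Mono ((presheafToSheaf J _).map (free'.map (yoneda.map i))))
  -- Sections of `F` over `U` are the morphisms to `F` from the sheaf freely generated by `U`.
  let e (U : C) : (free.obj (yoneda.obj U) ⟶ F) ≃ F.obj.obj (op U) :=
    (adj.homEquiv _ F).trans yonedaEquiv
  have e_map_comp (α : free.obj (yoneda.obj V) ⟶ F) :
      e W (free.map (yoneda.map i) ≫ α) = F.obj.map i.op (e V α) :=
    (congrArg yonedaEquiv (adj.homEquiv_naturality_left _ _)).trans
      (yonedaEquiv_naturality _ i).symm
  intro s
  refine ⟨e V (Injective.factorThru ((e W).symm s) (free.map (yoneda.map i))), ?_⟩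
  rw [← e_map_comp, Injective.comp_factorThru, Equiv.apply_symm_apply]

instance isFlasque_of_injective (F : Sh Y) [Injective F] : TopCat.Sheaf.IsFlasque F where
  epi i :=
    have : Injective (C := Sheaf (Opens.grothendieckTopology Y) AddCommGrpCat.{u}) F := ‹_›
    (AddCommGrpCat.epi_iff_surjective _).2 (map_surjective_of_injective F i.unop)

lemma res_surjective (F : Sh Y) [TopCat.Sheaf.IsFlasque F] {V W : Opens Y} (h : W ≤ V) :
    Function.Surjective (res F h) :=
  (AddCommGrpCat.epi_iff_surjective _).1 (TopCat.Presheaf.IsFlasque.epi (homOfLE h).op)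

lemma exists_extension_of_disjoint (F : Sh Y) [TopCat.Sheaf.IsFlasque F] {V W T : Opens Y}
    (h : W ≤ V) (s : F.presheaf.obj (op W)) (hs : Disjoint (supp F s) T) :
    ∃ t : F.presheaf.obj (op V), res F h t = s ∧ Disjoint (supp F t) T := by
  have h0 : res F (inf_le_left : W ⊓ (V ⊓ T) ≤ W) s = 0 :=
    (res_eq_zero_iff F _ s).2 (hs.mono_right fun _ hy ↦ hy.2.2)
  obtain ⟨t₀, ht₁, ht₂⟩ := exists_glue₂ F (le_sup_left : W ≤ W ⊔ (V ⊓ T)) le_sup_right le_rfl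
    s 0 (by rw [h0, map_zero])
  obtain ⟨t, rfl⟩ := res_surjective F (sup_le h inf_le_left) t₀
  rw [res_res] at ht₁ ht₂
  refine ⟨t, ht₁, Set.disjoint_left.2 fun y hy hyT ↦ ?_⟩
  exact Set.disjoint_left.1 ((res_eq_zero_iff F _ t).1 ht₂) hy ⟨supp_subset F t hy, hyT⟩

end Flasque

variable {X Z : TopCat.{u}}

lemma mem_properSections_iff_properOver (f : Y ⟶ X) (F : Sh Y) {U : Opens X}
    {s : F.presheaf.obj (op ((Opens.map f).obj U))} :
    s ∈ properSections f F U ↔ ProperOver f (supp F s) U := by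
  rw [mem_properSections, hasProperSupport_iff]
  constructor
  · intro h 𝒰 h𝒰 x hx hf
    obtain ⟨y, hy, e, hle⟩ := h 𝒰 h𝒰 x hx hf
    exact ⟨y, mem_of_supp_mem F s 𝒰 h𝒰 y hy hle, e, hle⟩
  · intro h 𝒰 h𝒰 x hx hf
    obtain ⟨y, hy, e, hle⟩ := h 𝒰 h𝒰 x hx hf
    exact ⟨y, supp_subset F s hy, e, hle⟩

lemma mem_properSections_of_supp_subset (f : Y ⟶ X) (F : Sh Y) {U : Opens X}
    {s : F.presheaf.obj (op ((Opens.map f).obj U))} {A : Set Y} (hA : ProperOver f A U)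
    (h : supp F s ⊆ A) : s ∈ properSections f F U := by
  refine (mem_properSections_iff_properOver f F).2 (hA.of_subset h fun y hy hyU ↦ ?_)
  obtain ⟨𝒰, hs, hle⟩ := mem_closure_iff_ultrafilter.1 hy
  exact mem_of_supp_mem F s 𝒰 hs y hyU hle

lemma map_obj_mono (f : Y ⟶ X) {U V : Opens X} (h : V ≤ U) :
    (Opens.map f).obj V ≤ (Opens.map f).obj U :=
  fun _ hy ↦ h hy

/-- A sheaf on `Y` is soft relative to `f : Y ⟶ X` if every section on a neighbourhood of a
compact subset `K` of a fiber of `f` coincides near `K` with a section with proper support over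
a neighbourhood of the base point of the fiber. -/
def IsRelSoft (f : Y ⟶ X) : ObjectProperty (Sh Y) := fun F ↦
  ∀ (x : X) (K : Set Y), IsCompact K → K ⊆ f ⁻¹' {x} → ∀ V : Opens Y, K ⊆ V →
    ∀ s : F.presheaf.obj (op V), ∃ U : Opens X, x ∈ U ∧ ∃ t ∈ properSections f F U,
      ∃ W : Opens Y, K ⊆ W ∧ ∃ (h₁ : W ≤ V) (h₂ : W ≤ (Opens.map f).obj U),
        res F h₁ s = res F h₂ t

-- Near `K`, a section `s` of `g_(!) F` is cut off by extending it by zero outside a neighbourhood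
-- `A` of `K` which is proper over the base; the extension is possible since `F` is flasque, and its
-- support is proper over the base because the one of `s` is proper over `A`.
lemma isRelSoft_properDirectImage (g : Z ⟶ Y) (f : Y ⟶ X) (hf : IsSeparatedMap f)
    (hlp : IsLocallyProper f) (F : Sh Z) [TopCat.Sheaf.IsFlasque F] :
    IsRelSoft f ((properDirectImage g).obj F) := by
  rintro x K hK hKx V hKV ⟨s, hs : s ∈ properSections g F V⟩
  obtain ⟨A, U, hAV, hKA, hx, hA⟩ := hlp.exists_properOver hK hKx V.isOpen hKV
  let I : Opens Y := ⟨interior A, isOpen_interior⟩ ⊓ (Opens.map f).obj U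
  let T : Opens Z :=
    (Opens.map g).obj ⟨(closure A)ᶜ, isClosed_closure.isOpen_compl⟩ ⊔ vanishing F s
  have hKI : K ⊆ I :=
    Set.subset_inter hKA (hKx.trans (Set.preimage_mono (Set.singleton_subset_iff.2 hx)))
  have hIV : I ≤ V := inf_le_left.trans (interior_subset.trans hAV)
  have hIU : I ≤ (Opens.map f).obj U := inf_le_right
  have disjoint_supp_res : Disjoint (supp F (res F (map_obj_mono g hIV) s)) T := by
    rw [supp_res, Set.disjoint_left]
    rintro z ⟨hz, hzI⟩ (hzT | hzT)
    · exact hzT (subset_closure (interior_subset hzI.1))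
    · exact hzT.2 hz
  obtain ⟨t, hts, htT⟩ := exists_extension_of_disjoint F (map_obj_mono g hIU) _ disjoint_supp_res
  have supp_t : supp F t ⊆ supp F s ∩ g ⁻¹' A := by
    intro z hz
    have hzT := Set.disjoint_left.1 htT hz
    have hzA : g z ∈ A := hA.mem_of_mem_closure hlp.1 hf (by_contra fun h ↦ hzT (.inl h))
      (supp_subset F t hz)
    exact ⟨by_contra fun h ↦ hzT (.inr ⟨hAV hzA, h⟩), hzA⟩
  have ht : t ∈ properSections (g ≫ f) F U := mem_properSections_of_supp_subset (g ≫ f) F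
    (((mem_properSections_iff_properOver g F).1 hs).inter_preimage hA hAV) supp_t
  exact ⟨U, hx, ⟨t, mem_properSections_left g f hf F U t ht⟩,
    mem_properSections_right g f hf F U t ht, I, hKI, hIV, hIU, Subtype.ext hts.symm⟩

lemma isRelSoft_of_isFlasque (f : Y ⟶ X) (hf : IsSeparatedMap f) (hlp : IsLocallyProper f)
    (F : Sh Y) [TopCat.Sheaf.IsFlasque F] : IsRelSoft f F := by
  intro x K hK hKx V hKV s
  have hs : s ∈ properSections (𝟙 Y) F V :=
    (mem_properSections_iff_properOver (𝟙 Y) F).2 fun 𝒰 h y hy hle ↦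
      ⟨y, mem_of_supp_mem F s 𝒰 h y hy hle, rfl, hle⟩
  obtain ⟨U, hx, t, ht, W, hKW, h₁, h₂, e⟩ :=
    isRelSoft_properDirectImage (𝟙 Y) f hf hlp F x K hK hKx V hKV ⟨s, hs⟩
  exact ⟨U, hx, t.1, mem_properSections_comp_of_mem (𝟙 Y) f F U t ht, W, hKW, h₁, h₂,
    congrArg Subtype.val e⟩

section Lift

variable {F G : Sh Y} (φ : F ⟶ G) {V : Opens Y} (s : G.presheaf.obj (op V)) {K L : Set Y}

/-- The section `s` of `G` over `V` lifts along `φ : F ⟶ G` to a section of `F` over some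
neighbourhood of `K`. -/
def LiftsNear (K : Set Y) : Prop :=
  ∃ W : Opens Y, K ⊆ W ∧ ∃ (h : W ≤ V) (t : F.presheaf.obj (op W)), onSections φ W t = res G h s

variable {φ s}

lemma LiftsNear.mono (h : LiftsNear φ s L) (hKL : K ⊆ L) : LiftsNear φ s K := by
  obtain ⟨W, hLW, h⟩ := h
  exact ⟨W, hKL.trans hLW, h⟩

variable (φ s) in
lemma liftsNear_of_disjoint (hKV : K ⊆ V) (hK : Disjoint K (supp G s)) : LiftsNear φ s K := by
  refine ⟨vanishing G s, fun y hy ↦ ⟨hKV hy, Set.disjoint_left.1 hK hy⟩, fun _ hy ↦ hy.1, 0, ?_⟩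
  exact (map_zero _).trans (res_vanishing G s).symm

lemma exists_lift_glue {W₁ W₂ N D D₁ D₂ : Opens Y} {hW₁ : W₁ ≤ V} {hW₂ : W₂ ≤ V}
    {t₁ : F.presheaf.obj (op W₁)} {t₂ : F.presheaf.obj (op W₂)}
    (e₁ : onSections φ W₁ t₁ = res G hW₁ s) (e₂ : onSections φ W₂ t₂ = res G hW₂ s)
    {hN₁ : N ≤ W₁} {hN₂ : N ≤ W₂} (e : res F hN₁ t₁ = res F hN₂ t₂) (h₁ : D₁ ≤ W₁) (h₂ : D₂ ≤ W₂)
    (hN : D₁ ⊓ D₂ ≤ N) (hD₁ : D₁ ≤ D) (hD₂ : D₂ ≤ D) (hD : D ≤ D₁ ⊔ D₂) (hDV : D ≤ V) :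
    ∃ t : F.presheaf.obj (op D), onSections φ D t = res G hDV s ∧
      res F hD₁ t = res F h₁ t₁ ∧ res F hD₂ t = res F h₂ t₂ := by
  obtain ⟨t, ht₁, ht₂⟩ := exists_glue₂ F hD₁ hD₂ hD (res F h₁ t₁) (res F h₂ t₂) (by
    simpa only [res_res] using congrArg (res F hN) e)
  refine ⟨t, section_ext₂ G hD₁ hD₂ hD ?_ ?_, ht₁, ht₂⟩
  · rw [← onSections_res, ht₁, onSections_res, e₁, res_res, res_res]
  · rw [← onSections_res, ht₂, onSections_res, e₂, res_res, res_res]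

lemma exists_lift_properSections_of_frontier {f : Y ⟶ X} {A : Set Y} {U : Opens X}
    (hA : ProperOver f A U) {s : G.presheaf.obj (op ((Opens.map f).obj U))}
    (hsA : supp G s ⊆ interior A) {W N : Opens Y} {hW : W ≤ (Opens.map f).obj U}
    (hAW : interior A ∩ f ⁻¹' U ⊆ W) {a : F.presheaf.obj (op W)}
    (ha : onSections φ W a = res G hW s)
    {hN : N ≤ W} (hAN : frontier A ∩ f ⁻¹' U ⊆ N) (haN : res F hN a = 0) :
    ∃ t ∈ properSections f F U, onSections φ _ t = s := by
  let D : Opens Y := (Opens.map f).obj U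
  let D₁ : Opens Y := ⟨interior A, isOpen_interior⟩ ⊓ D
  let D₂ : Opens Y := N ⊔ (⟨(closure A)ᶜ, isClosed_closure.isOpen_compl⟩ ⊓ D)
  have hNs : N ≤ vanishing G s := by
    rw [← res_eq_zero_iff_le_vanishing G (hN.trans hW), ← res_res G hW hN, ← ha, ← onSections_res,
      haN, map_zero]
  have hD₂s : D₂ ≤ vanishing G s := sup_le hNs fun y hy ↦
    ⟨hy.2, fun h ↦ hy.1 (subset_closure (interior_subset (hsA h)))⟩
  have hD : D ≤ D₁ ⊔ D₂ := by
    intro y hy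
    by_cases hyI : y ∈ interior A
    · exact .inl ⟨hyI, hy⟩
    · by_cases hyA : y ∈ closure A
      · exact .inr (.inl (hAN ⟨⟨hyA, hyI⟩, hy⟩))
      · exact .inr (.inr ⟨hyA, hy⟩)
  have hD₁₂ : D₁ ⊓ D₂ ≤ N := fun y hy ↦
    hy.2.resolve_right fun h ↦ h.1 (subset_closure (interior_subset hy.1.1))
  obtain ⟨t, ht, -, ht₂⟩ := exists_lift_glue (t₂ := 0) ha
    ((map_zero _).trans (res_vanishing G s).symm)
    (hN₂ := hNs) (haN.trans (map_zero _).symm) hAW hD₂s hD₁₂ inf_le_right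
    (sup_le (hN.trans hW) inf_le_right) hD le_rfl
  rw [res_self] at ht
  rw [map_zero, res_eq_zero_iff] at ht₂
  refine ⟨t, mem_properSections_of_supp_subset f F hA fun y hy ↦ ?_, ht⟩
  exact interior_subset
    ((hD (supp_subset F t hy)).resolve_right (Set.disjoint_left.1 ht₂ hy)).1

end Lift

section ShortExact

variable {f : Y ⟶ X} {S : ShortComplex (Sh Y)} {x : X} {K L : Set Y} {V : Opens Y}
  {s : S.X₃.presheaf.obj (op V)}

-- The difference of the two lifts comes from `S.X₁`, where it is extended from a neighbourhood
-- of `K` and then subtracted from the first lift.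
lemma IsRelSoft.exists_lift_eq_near (h : IsRelSoft f S.X₁) (hS : S.ShortExact) (hK : IsCompact K)
    (hKx : K ⊆ f ⁻¹' {x}) {W₁ W₂ : Opens Y} {hW₁ : W₁ ≤ V} {hW₂ : W₂ ≤ V} (hK₁ : K ⊆ W₁)
    (hK₂ : K ⊆ W₂) {t₁ : S.X₂.presheaf.obj (op W₁)} {t₂ : S.X₂.presheaf.obj (op W₂)}
    (e₁ : onSections S.g W₁ t₁ = res S.X₃ hW₁ s) (e₂ : onSections S.g W₂ t₂ = res S.X₃ hW₂ s) :
    ∃ U : Opens X, x ∈ U ∧ ∃ t : S.X₂.presheaf.obj (op (W₁ ⊓ (Opens.map f).obj U)),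
      onSections S.g _ t = res S.X₃ (inf_le_left.trans hW₁) s ∧
      ∃ N : Opens Y, K ⊆ N ∧ ∃ (hN₁ : N ≤ W₁ ⊓ (Opens.map f).obj U) (hN₂ : N ≤ W₂),
        res S.X₂ hN₁ t = res S.X₂ hN₂ t₂ := by
  obtain ⟨d, hd⟩ := exists_of_onSections_eq_zero hS
    (res S.X₂ (inf_le_left : W₁ ⊓ W₂ ≤ W₁) t₁ - res S.X₂ inf_le_right t₂) (by
      rw [map_sub, onSections_res, onSections_res, e₁, e₂, res_res, res_res, sub_self])
  obtain ⟨U, hx, b, -, N, hKN, hNW, hNU, hdb⟩ :=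
    h x K hK hKx (W₁ ⊓ W₂) (Set.subset_inter hK₁ hK₂) d
  refine ⟨U, hx, res S.X₂ inf_le_left t₁ - onSections S.f _ (res S.X₁ inf_le_right b), ?_,
    N, hKN, le_inf (hNW.trans inf_le_left) hNU, hNW.trans inf_le_right, ?_⟩
  · rw [map_sub, onSections_g_onSections_f, sub_zero, onSections_res, e₁, res_res]
  · have e : onSections S.f N (res S.X₁ hNU b) =
        res S.X₂ (hNW.trans inf_le_left) t₁ - res S.X₂ (hNW.trans inf_le_right) t₂ := by
      rw [← hdb, onSections_res, hd, map_sub, res_res, res_res]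
    rw [map_sub, ← onSections_res, res_res, res_res, e, sub_sub_cancel]

lemma IsRelSoft.liftsNear_union (h : IsRelSoft f S.X₁) (hS : S.ShortExact) (hf : IsSeparatedMap f)
    (hK : IsCompact K) (hL : IsCompact L) (hKx : K ⊆ f ⁻¹' {x}) (hLx : L ⊆ f ⁻¹' {x})
    (hsK : LiftsNear S.g s K) (hsL : LiftsNear S.g s L) : LiftsNear S.g s (K ∪ L) := by
  obtain ⟨W₁, hKW₁, hW₁, t₁, e₁⟩ := hsK
  obtain ⟨W₂, hLW₂, hW₂, t₂, e₂⟩ := hsL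
  obtain ⟨U, hx, t, e, W, hW, hWW₁, hWW₂, htt₂⟩ := h.exists_lift_eq_near hS
    (isCompact_inter_of_isSeparatedMap hf hK hL hKx hLx) (Set.inter_subset_left.trans hKx)
    (Set.inter_subset_left.trans hKW₁) (Set.inter_subset_right.trans hLW₂) e₁ e₂
  obtain ⟨N, M, hKN, hLM, hNM⟩ := exists_opens_inf_le_of_isSeparatedMap hf hK hL hKx hLx hW
  let D₁ : Opens Y := N ⊓ (W₁ ⊓ (Opens.map f).obj U)
  let D₂ : Opens Y := M ⊓ W₂
  have hKD₁ : K ⊆ D₁ := Set.subset_inter hKN (Set.subset_inter hKW₁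
    (hKx.trans (Set.preimage_mono (Set.singleton_subset_iff.2 hx))))
  have hLD₂ : L ⊆ D₂ := fun y hy ↦ ⟨hLM hy, hLW₂ hy⟩
  have hDV : D₁ ⊔ D₂ ≤ V :=
    sup_le (inf_le_right.trans (inf_le_left.trans hW₁)) (inf_le_right.trans hW₂)
  obtain ⟨t', e', -⟩ := exists_lift_glue e e₂ htt₂ (inf_le_right : D₁ ≤ _)
    (inf_le_right : D₂ ≤ _) ((inf_le_inf inf_le_left inf_le_left).trans hNM) le_sup_left
    le_sup_right le_rfl hDV
  exact ⟨D₁ ⊔ D₂, Set.union_subset_union hKD₁ hLD₂, hDV, t', e'⟩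

lemma IsRelSoft.liftsNear (h : IsRelSoft f S.X₁) (hS : S.ShortExact) (hf : IsSeparatedMap f)
    (hlp : IsLocallyProper f) (hK : IsCompact K) (hKx : K ⊆ f ⁻¹' {x}) (hKV : K ⊆ V)
    (s : S.X₃.presheaf.obj (op V)) : LiftsNear S.g s K := by
  suffices ∃ L : Set Y, IsCompact L ∧ L ⊆ f ⁻¹' {x} ∧ K ⊆ L ∧ LiftsNear S.g s L by
    obtain ⟨L, -, -, hKL, hsL⟩ := this
    exact hsL.mono hKL
  refine hK.induction_on (p := fun T ↦ ∃ L : Set Y, IsCompact L ∧ L ⊆ f ⁻¹' {x} ∧ T ⊆ L ∧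
    LiftsNear S.g s L) ?_ ?_ ?_ ?_
  · exact ⟨∅, isCompact_empty, Set.empty_subset _, le_rfl,
      liftsNear_of_disjoint S.g s (Set.empty_subset _) (Set.empty_disjoint _)⟩
  · rintro T T' hT ⟨L, hL, hLx, hTL, hsL⟩
    exact ⟨L, hL, hLx, hT.trans hTL, hsL⟩
  · rintro T₁ T₂ ⟨L₁, hL₁, hLx₁, hTL₁, hsL₁⟩ ⟨L₂, hL₂, hLx₂, hTL₂, hsL₂⟩
    exact ⟨L₁ ∪ L₂, hL₁.union hL₂, Set.union_subset hLx₁ hLx₂, Set.union_subset_union hTL₁ hTL₂,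
      h.liftsNear_union hS hf hL₁ hL₂ hLx₁ hLx₂ hsL₁ hsL₂⟩
  · intro y hy
    obtain ⟨W, hWV, hyW, t, ht⟩ := (epi_iff_locally_surjective S.g).1 hS.epi_g V s y (hKV hy)
    obtain ⟨L, hL, hLW, hLx, hLy⟩ :=
      hlp.exists_isCompact_subset_fiber (hKx hy) (W.isOpen.mem_nhds hyW)
    exact ⟨L, nhdsWithin_mono y hKx hLy, L, hL, hLx, le_rfl, W, hLW, hWV, t, ht⟩

-- A lift near `K` (the part of the support of `s` in the fiber) is made to vanish near the frontier
-- of a neighbourhood `A` of `K` which is proper over the base, and is then extended by zero.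
lemma IsRelSoft.exists_lift_properSections (h : IsRelSoft f S.X₁) (hS : S.ShortExact)
    (hf : IsSeparatedMap f) (hlp : IsLocallyProper f) {U : Opens X} (hx : x ∈ U)
    {s : S.X₃.presheaf.obj (op ((Opens.map f).obj U))} (hs : s ∈ properSections f S.X₃ U) :
    ∃ (U' : Opens X) (h : U' ≤ U), x ∈ U' ∧ ∃ t ∈ properSections f S.X₂ U',
      onSections S.g _ t = res S.X₃ (map_obj_mono f h) s := by
  rw [mem_properSections_iff_properOver] at hs
  obtain ⟨W, hKW, hWU, a, ha⟩ := h.liftsNear hS hf hlp (hs.isCompact_inter_fiber hx)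
    Set.inter_subset_right (fun y hy ↦ supp_subset _ _ hy.1) s
  obtain ⟨A, U₁, hAW, hKA, hx₁, hA⟩ := hlp.exists_properOver (hs.isCompact_inter_fiber hx)
    Set.inter_subset_right W.isOpen hKW
  have hB := hA.frontier hlp.1 hf U₁.isOpen
  have hBW : frontier A ∩ f ⁻¹' {x} ⊆ W := by
    rintro y ⟨hy, rfl⟩
    exact hAW (hA.mem_of_mem_closure hlp.1 hf hy.1 hx₁)
  have hBs : frontier A ∩ f ⁻¹' {x} ⊆ vanishing S.X₃ s :=
    fun y hy ↦ ⟨hWU (hBW hy), fun h ↦ hy.1.2 (hKA ⟨h, hy.2⟩)⟩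
  obtain ⟨U₂, hx₂, a', ha', N, hBN, hNW, _, haN⟩ := h.exists_lift_eq_near hS (t₂ := 0)
    (hB.isCompact_inter_fiber hx₁) Set.inter_subset_right hBW hBs ha
    ((map_zero _).trans (res_vanishing S.X₃ s).symm)
  obtain ⟨U₃, hx₃, hU₃⟩ := hB.exists_inter_preimage_subset hx₁ N.isOpen hBN
  obtain ⟨U₄, hx₄, hU₄⟩ := hs.exists_inter_preimage_subset hx isOpen_interior hKA
  let U' : Opens X := U ⊓ (U₁ ⊓ (U₂ ⊓ (U₃ ⊓ U₄)))
  let D : Opens Y := (Opens.map f).obj U'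
  have hU'U₁ : (U' : Set X) ⊆ U₁ := fun _ hy ↦ hy.2.1
  refine ⟨U', inf_le_left, ⟨hx, hx₁, hx₂, hx₃, hx₄⟩,
    exists_lift_properSections_of_frontier (φ := S.g) (W := (W ⊓ (Opens.map f).obj U₂) ⊓ D)
      (hW := inf_le_right) (a := res S.X₂ inf_le_left a') (N := N ⊓ D)
      (hN := inf_le_inf_right D hNW) (hA.mono hU'U₁) ?_ ?_ ?_ ?_ ?_⟩
  · rw [supp_res]
    exact fun y hy ↦ hU₄ ⟨hy.1, hy.2.2.2.2.2⟩
  · exact fun y hy ↦ ⟨⟨hAW (interior_subset hy.1), hy.2.2.2.1⟩, hy.2⟩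
  · rw [onSections_res, ha', res_res, res_res]
  · exact fun y hy ↦ ⟨hU₃ ⟨hy.1, hy.2.2.2.2.1⟩, hy.2⟩
  · rw [res_res, ← res_res S.X₂ hNW inf_le_left, haN, map_zero, map_zero]

lemma IsRelSoft.quotient (h₁ : IsRelSoft f S.X₁) (h₂ : IsRelSoft f S.X₂) (hS : S.ShortExact)
    (hf : IsSeparatedMap f) (hlp : IsLocallyProper f) : IsRelSoft f S.X₃ := by
  intro x K hK hKx V hKV s
  obtain ⟨V', hKV', hV', a, ha⟩ := h₁.liftsNear hS hf hlp hK hKx hKV s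
  obtain ⟨U, hx, t, ht, W, hKW, hWV', hWU, e⟩ := h₂ x K hK hKx V' hKV' a
  refine ⟨U, hx, onSections S.g _ t, app_mem_properSections f S.g U ht, W, hKW,
    hWV'.trans hV', hWU, ?_⟩
  rw [← onSections_res, ← e, onSections_res, ha, res_res]

lemma IsRelSoft.shortExact_map (h : IsRelSoft f S.X₁) (hS : S.ShortExact) (hf : IsSeparatedMap f)
    (hlp : IsLocallyProper f) : (S.map (properDirectImage f)).ShortExact where
  exact := by
    have := hS.mono_f
    refine exact_of_onSections _ ?_
    rintro U ⟨s, hs : s ∈ properSections f S.X₂ U⟩ hs0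
    obtain ⟨t, rfl⟩ := exists_of_onSections_eq_zero hS s (congrArg Subtype.val hs0)
    rw [mem_properSections_iff_properOver, supp_onSections_of_mono] at hs
    exact ⟨⟨t, (mem_properSections_iff_properOver f S.X₁).2 hs⟩, rfl⟩
  mono_f := by
    have := hS.mono_f
    exact mono_of_onSections_injective _ fun U s t hst ↦
      Subtype.ext (onSections_injective S.f _ (congrArg Subtype.val hst))
  epi_g := by
    refine (epi_iff_locally_surjective _).2 fun U s x hx ↦ ?_
    obtain ⟨U', h', hx', t, ht, e⟩ := h.exists_lift_properSections hS hf hlp hx s.2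
    exact ⟨U', h', hx', ⟨t, ht⟩, Subtype.ext e⟩

end ShortExact

lemma IsRelSoft.biprod {f : Y ⟶ X} {F G : Sh Y} (hF : IsRelSoft f F) (hG : IsRelSoft f G) :
    IsRelSoft f (F ⊞ G) := by
  intro x K hK hKx V hKV s
  let p₁ : F ⊞ G ⟶ F := biprod.fst
  let p₂ : F ⊞ G ⟶ G := biprod.snd
  let i₁ : F ⟶ F ⊞ G := biprod.inl
  let i₂ : G ⟶ F ⊞ G := biprod.inr
  obtain ⟨U₁, hx₁, t₁, ht₁, W₁, hKW₁, hWV₁, hWU₁, e₁⟩ :=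
    hF x K hK hKx V hKV (onSections p₁ V s)
  obtain ⟨U₂, hx₂, t₂, ht₂, W₂, hKW₂, hWV₂, hWU₂, e₂⟩ :=
    hG x K hK hKx V hKV (onSections p₂ V s)
  have hWU : W₁ ⊓ W₂ ≤ (Opens.map f).obj (U₁ ⊓ U₂) := inf_le_inf hWU₁ hWU₂
  have eq_add : s = onSections i₁ V (onSections p₁ V s) +
      onSections i₂ V (onSections p₂ V s) :=
    (ConcreteCategory.congr_hom
      (congrArg (fun φ : F ⊞ G ⟶ F ⊞ G ↦ φ.1.app (op V)) biprod.total) s).symm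
  refine ⟨U₁ ⊓ U₂, ⟨hx₁, hx₂⟩,
    onSections i₁ _ (res F (map_obj_mono f inf_le_left) t₁) +
      onSections i₂ _ (res G (map_obj_mono f inf_le_right) t₂),
    add_mem (app_mem_properSections f _ _ (map_mem_properSections f F (homOfLE inf_le_left) ht₁))
      (app_mem_properSections f _ _ (map_mem_properSections f G (homOfLE inf_le_right) ht₂)),
    W₁ ⊓ W₂, Set.subset_inter hKW₁ hKW₂, inf_le_left.trans hWV₁, hWU, ?_⟩
  replace e₁ := congrArg (res F (inf_le_left : W₁ ⊓ W₂ ≤ W₁)) e₁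
  replace e₂ := congrArg (res G (inf_le_right : W₁ ⊓ W₂ ≤ W₂)) e₂
  rw [res_res, res_res] at e₁ e₂
  rw [map_add, ← onSections_res, ← onSections_res, res_res, res_res, ← e₁, ← e₂, onSections_res,
    onSections_res, ← map_add, ← eq_add]

theorem isAdapted_isRelSoft (f : Y ⟶ X) (hf : IsSeparatedMap f) (hlp : IsLocallyProper f) :
    DerivedPlus.IsAdapted (IsRelSoft f) (properDirectImage f) where
  injective F := isRelSoft_of_isFlasque f hf hlp F
  biprod _ _ hF hG := hF.biprod hG
  shortExact_map _ hS h := h.shortExact_map hS hf hlp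
  quotient _ hS h₁ h₂ := h₁.quotient h₂ hS hf hlp

end Sh

theorem theoremt_general {X Y Z : TopCat.{u}}
    [HasDerivedCategory.{w₁} (Sh Z)] [HasDerivedCategory.{w₂} (Sh Y)]
    [HasDerivedCategory.{w₃} (Sh X)]
    (g : Z ⟶ Y) (f : Y ⟶ X)
    (hf_sep : IsSeparatedMap f) (hf_lp : IsLocallyProper f) :
    (Sh.derivedProperDirectImage (g ≫ f)).IsTriangulated ∧
    (Sh.derivedProperDirectImage g ⋙ Sh.derivedProperDirectImage f).IsTriangulated ∧
    NatTrans.CommShift (Sh.derivedProperDirectImageComparison g f hf_sep) ℤ ∧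
    IsIso (Sh.derivedProperDirectImageComparison g f hf_sep) :=
  ⟨inferInstance, inferInstance, DerivedPlus.commShift_rightDerivedComparison _,
    DerivedPlus.isIso_rightDerivedComparison _ (Sh.isAdapted_isRelSoft f hf_sep hf_lp)
      fun F _ ↦ Sh.isRelSoft_properDirectImage g f hf_sep hf_lp F⟩

theorem theoremt {X Y Z : TopCat.{u}}
    [HasDerivedCategory.{w₁} (Sh Z)] [HasDerivedCategory.{w₂} (Sh Y)]
    [HasDerivedCategory.{w₃} (Sh X)]
    (g : Z ⟶ Y) (f : Y ⟶ X)
    (hg_sep : IsSeparatedMap g) (hg_lp : IsLocallyProper g)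
    (hf_sep : IsSeparatedMap f) (hf_lp : IsLocallyProper f) :
    (Sh.derivedProperDirectImage (g ≫ f)).IsTriangulated ∧
    (Sh.derivedProperDirectImage g ⋙ Sh.derivedProperDirectImage f).IsTriangulated ∧
    NatTrans.CommShift (Sh.derivedProperDirectImageComparison g f hf_sep) ℤ ∧
    IsIso (Sh.derivedProperDirectImageComparison g f hf_sep) :=
  theoremt_general g f hf_sep hf_lp
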